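/- Let $$B=\langle a_1,t_1,a_2,t_2\mid t_1a_1^2t_1^{-1}a_1^{-3},\ t_2a_2^2t_2^{-1}a_2^{-3},\ t_2^{-1}[a_1,t_1a_1t_1^{-1}],\ t_1^{-1}[a_2,t_2a_2t_2^{-1}]\rangle$$ and $$\Lambda=\langle \alpha_1,\tau_1,\alpha_2,\tau_2,\zeta\mid [\alpha_1,\zeta]=[\tau_1,\zeta]=1\rangle ,$$ where $[x,y]=xyx^{-1}y^{-1}$. For $n\in\mathbb N=\{0,1,2,\dots\}$ let $q_n:\Lambda\to B$ be the homomorphism with $q_n(\alpha_i)=a_i^{2^n}$, $q_n(\tau_i)=t_i$ $(i=1,2)$ and $q_n(\zeta)=1$. Then: 1. every $q_n$ is surjective; 2. if $n\neq m$, there is no automorphism $\phi:\Lambda\to\Lambda$ such that $\phi(\ker q_n)=\ker q_m$; 3. consequently, if $\Gamma$ is a torsion-free (Gromov) hyperbolic group, $\pi_0:\Gamma\to B$ is an epimorphism, and $$\Pi_n=\{(x,y)\in\Gamma\times\Lambda\mid \pi_0(x)=q_n(y)\}<\Gamma\times\Lambda ,$$ then the groups $\Pi_n$ and $\Pi_m$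 are not isomorphic whenever $n\neq m$. -/

import Mathlib

open scoped commutatorElement

/-- The generators `a i`, `t i` of the group `B` (`i = 0, 1` stands for the indices `1, 2`). -/
inductive BGen : Type
  | a (i : Fin 2)
  | t (i : Fin 2)

namespace BGen

/-- The free-group word `t_i a_i² t_i⁻¹ a_i⁻³`. -/
def bsRel (i : Fin 2) : FreeGroup BGen :=
  FreeGroup.of (t i) * FreeGroup.of (a i) ^ 2 * (FreeGroup.of (t i))⁻¹ *
    (FreeGroup.of (a i) ^ 3)⁻¹

/-- The free-group word `t_j⁻¹ [a_i, t_i a_i t_i⁻¹]`. -/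
def amalgRel (i j : Fin 2) : FreeGroup BGen :=
  (FreeGroup.of (t j))⁻¹ *
    ⁅FreeGroup.of (a i), FreeGroup.of (t i) * FreeGroup.of (a i) * (FreeGroup.of (t i))⁻¹⁆

/-- The four defining relators of `B`. -/
def rels : Set (FreeGroup BGen) :=
  {bsRel 0, bsRel 1, amalgRel 0 1, amalgRel 1 0}

end BGen

/-- The group `B = ⟨a₁, t₁, a₂, t₂ | t₁a₁²t₁⁻¹a₁⁻³, t₂a₂²t₂⁻¹a₂⁻³,
t₂⁻¹[a₁, t₁a₁t₁⁻¹], t₁⁻¹[a₂, t₂a₂t₂⁻¹]⟩`. -/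
abbrev GroupB : Type := PresentedGroup BGen.rels

/-- The generators `α i`, `τ i`, `ζ` of the group `Λ`
(`i = 0, 1` stands for the indices `1, 2`). -/
inductive LambdaGen : Type
  | α (i : Fin 2)
  | τ (i : Fin 2)
  | ζ

namespace LambdaGen

/-- The two defining relators `[α₁, ζ]` and `[τ₁, ζ]` of `Λ`. -/
def rels : Set (FreeGroup LambdaGen) :=
  {⁅FreeGroup.of (α 0), FreeGroup.of ζ⁆, ⁅FreeGroup.of (τ 0), FreeGroup.of ζ⁆}

/-- The images in `B` of the generators of `Λ`: `α_i ↦ a_i ^ (2 ^ n)`, `τ_i ↦ t_i`, `ζ ↦ 1`. -/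
def toB (n : ℕ) : LambdaGen → GroupB
  | α i => PresentedGroup.of (BGen.a i) ^ (2 ^ n)
  | τ i => PresentedGroup.of (BGen.t i)
  | ζ => 1

theorem lift_toB_eq_one (n : ℕ) : ∀ r ∈ rels, FreeGroup.lift (toB n) r = 1 := by
  rintro r (rfl | rfl) <;> simp [map_commutatorElement, toB]

end LambdaGen

/-- The group `Λ = ⟨α₁, τ₁, α₂, τ₂, ζ | [α₁, ζ] = [τ₁, ζ] = 1⟩`. -/
abbrev GroupLambda : Type := PresentedGroup LambdaGen.rels

/-- The homomorphism `q_n : Λ → B` with `α_i ↦ a_i ^ (2 ^ n)`, `τ_i ↦ t_i`, `ζ ↦ 1`. -/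
def qMap (n : ℕ) : GroupLambda →* GroupB :=
  PresentedGroup.toGroup (LambdaGen.lift_toB_eq_one n)

/-- The fibre product `{(x, y) | f x = g y}` of two homomorphisms to the same group, as a subgroup
of the direct product. -/
def fibreProduct {G H Q : Type*} [Group G] [Group H] [Group Q] (f : G →* Q) (g : H →* Q) :
    Subgroup (G × H) :=
  (f.comp (MonoidHom.fst G H)).eqLocus (g.comp (MonoidHom.snd G H))

/-- A group is (Gromov) hyperbolic if it has a finite generating set `S` such that the word metric
of `S` (the graph metric of the Cayley graph) satisfies Gromov's four-point condition for some
constant `δ`. -/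
def IsGromovHyperbolic (G : Type*) [Group G] : Prop :=
  ∃ S : Set G, S.Finite ∧ Subgroup.closure S = ⊤ ∧ ∃ δ : ℕ, ∀ x y z w : G,
    (SimpleGraph.mulCayley S).dist x y + (SimpleGraph.mulCayley S).dist z w ≤
      max ((SimpleGraph.mulCayley S).dist x z + (SimpleGraph.mulCayley S).dist y w)
        ((SimpleGraph.mulCayley S).dist x w + (SimpleGraph.mulCayley S).dist y z) + 2 * δ

/-!
`B` is the amalgam of two copies of `BS(2, 3) = ⟨a, t | t a² t⁻¹ = a³⟩` along a free group of rank
two, with `t` in each copy glued to `⁅a, t a t⁻¹⁆` in the other. Each `q n` restricts on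
`⟨α 0, τ 0⟩` to the map `freeMap n : α ↦ a ^ 2 ^ n, τ ↦ t` onto a copy of `BS(2, 3)` embedded in `B`
(`GroupB.ofBaumslagSolitar_injective`, from Britton's lemma and the normal form for amalgams).

*The kernels of `freeMap n` are inequivalent under `Aut(F₂)`*
(`BaumslagSolitar.eq_of_ker_freeMap_equiv`). An automorphism `θ` matching the kernels for `n` and `m`
induces an automorphism `χ` of `BS(2, 3)` with `χ ∘ freeMap n = freeMap m ∘ θ`. As `χ a` has
conjugate second and third powers, it is elliptic on the Bass–Serre tree, so `χ a` is conjugate to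
`a` or `a⁻¹`. On the other hand the class of `θ α` in the abelianization `ℤ[T, T⁻¹]` of
`ker (F₂ → ⟨τ⟩)` is a generator, hence `± T ^ j`. In the affine representation (`a` translation by
`1`, `t` multiplication by `3 / 2`) the two sides of `χ (a ^ 2 ^ n) = freeMap m (θ α)` are
translations by `± (3 / 2) ^ i * 2 ^ n` and `± (3 / 2) ^ j * 2 ^ m`, so `n = m`.

*Automorphisms of `Λ`* (`eq_of_ker_qMap_equiv`). `Λ` is the free product of `F₂ × ℤ`, with `ℤ`
generated by `ζ`, and of another `F₂`. By
`Monoid.CoprodI.centralizer_commutative_or_conj_of` the elements with noncommutative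
centralizer are the conjugates of powers of `ζ`. So an automorphism of `Λ` preserves, up to an inner
automorphism, the centralizer `F₂ × ℤ` of `ζ`, and induces an automorphism of `F₂`. Since `q n` kills
`ζ`, the previous paragraph applies.

*Fibre products* (`FibreProduct.eq_of_mulEquiv`). In a torsion-free hyperbolic group `Γ` commuting
with a nontrivial element is a transitive relation (`IsGromovHyperbolic.commute_of_commute`), and in
neither `Λ` nor `Γ` is there a pair of nontrivial elements all of whose conjugates commute with each
other. The kernels of the two projections of `Π n` commute, so an isomorphism `Π n ≃ Π m` is forced
to match these kernels; the alternative of exchanging them is excluded because the kernel of `q n`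
contains `ζ` together with noncommuting elements that commute with `ζ`. Hence it
induces an automorphism of `Λ` taking the kernel of `q n` to that of `q m`.
-/

/-! ### Hyperbolic groups -/

namespace SimpleGraph

variable {G : Type*} [Group G] (S : Set G)

theorem mulCayley_connected (hS : Subgroup.closure S = ⊤) : (mulCayley S).Connected := by
  have key : ∀ g : G, ∀ x : G, (mulCayley S).Reachable x (x * g) := by
    intro g
    have hg : g ∈ Subgroup.closure S := hS ▸ Subgroup.mem_top g
    induction hg using Subgroup.closure_induction with
    | mem s hs =>
      intro x
      by_cases h : x = x * s
      · rw [← h]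
      · exact Adj.reachable ((mulCayley_adj S _ _).2 ⟨h, Or.inl (by simpa using hs)⟩)
    | one => simp
    | mul a b _ _ iha ihb => exact fun x => (iha x).trans (by simpa [mul_assoc] using ihb (x * a))
    | inv a _ ih => exact fun x => by simpa using (ih (x * a⁻¹)).symm
  have : Nonempty G := ⟨1⟩
  exact ⟨fun x y => by simpa using key (x⁻¹ * y) x⟩

theorem mulCayley_dist_mul_left (hS : Subgroup.closure S = ⊤) (d u v : G) :
    (mulCayley S).dist (d * u) (d * v) = (mulCayley S).dist u v := by
  have hle : ∀ d u v : G, (mulCayley S).dist (d * u) (d * v) ≤ (mulCayley S).dist u v := by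
    intro d u v
    obtain ⟨p, hp⟩ := (mulCayley_connected S hS).exists_walk_length_eq_dist u v
    let f : mulCayley S →g mulCayley S := ⟨fun x => d * x, fun h => mulCayley_adj_mul_iff_right.2 h⟩
    rw [← hp, ← Walk.length_map f p]
    exact dist_le _
  refine le_antisymm (hle d u v) ?_
  simpa using hle d⁻¹ (d * u) (d * v)

theorem mulCayley_finite_ball (hS : Subgroup.closure S = ⊤) (hfin : S.Finite) (n : ℕ) :
    {x : G | (mulCayley S).dist 1 x ≤ n}.Finite := by
  induction n with
  | zero =>
    refine (Set.finite_singleton (1 : G)).subset fun x hx => ?_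
    have := ((mulCayley_connected S hS).dist_eq_zero_iff).1 (Nat.le_zero.1 hx)
    simp [this]
  | succ n ih =>
    refine (ih.union (ih.mul (hfin.union hfin.inv))).subset fun x hx => ?_
    by_cases hle : (mulCayley S).dist 1 x ≤ n
    · exact Or.inl hle
    right
    obtain ⟨p, hp⟩ := (mulCayley_connected S hS).exists_walk_length_eq_dist x 1
    rw [dist_comm] at hp
    cases p with
    | nil => exact absurd (by simp) hle
    | @cons _ v _ h q =>
      refine Set.mem_mul.2 ⟨v, ?_, v⁻¹ * x, ?_, by simp⟩
      · have := dist_le q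
        rw [dist_comm] at this
        simp only [Walk.length_cons] at hp
        simp only [Set.mem_ofPred_eq] at hx ⊢
        omega
      · rcases ((mulCayley_adj S _ _).1 h).2 with h | h
        · right; simpa using h
        · left; exact h

theorem Connected.exists_dist_eq {V : Type*} {G : SimpleGraph V} (hG : G.Connected) (x y : V)
    {s : ℕ} (hs : s ≤ G.dist x y) :
    ∃ z, G.dist x z = s ∧ G.dist z y = G.dist x y - s := by
  obtain ⟨p, hp⟩ := hG.exists_walk_length_eq_dist x y
  refine ⟨p.getVert s, ?_⟩
  have h1 := dist_le (p.take s)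
  have h2 := dist_le (p.drop s)
  have h3 := hG.dist_triangle (u := x) (v := p.getVert s) (w := y)
  have h4 := p.take_length s
  have h5 := p.drop_length s
  omega

end SimpleGraph

namespace IsGromovHyperbolic

open SimpleGraph

/-- In a hyperbolic group, an element commuting with `g` that is shortest in its coset modulo `⟨g⟩`
has bounded length: a point halfway between `1` and a long such element would be moved by a bounded
amount by many powers of `g`, contradicting finiteness of balls. -/
theorem exists_finite_centralizer_transversal {Γ : Type*} [Group Γ] (h : IsGromovHyperbolic Γ)
    {g : Γ} (hg : ¬ IsOfFinOrder g) :
    ∃ F : Set Γ, F.Finite ∧ ∀ x, Commute x g → ∃ k : ℤ, x * g ^ k ∈ F := by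
  obtain ⟨S, hfin, hS, δ, hδ⟩ := h
  have hconn := mulCayley_connected S hS
  have hinv := mulCayley_dist_mul_left S hS
  have hball := mulCayley_finite_ball S hS hfin
  set d := (mulCayley S).dist with hd
  have htri : ∀ x y z, d x z ≤ d x y + d y z := fun x y z => hconn.dist_triangle
  have hcomm : ∀ x y, d x y = d y x := fun x y => (mulCayley S).dist_comm
  -- more than `M` powers of `g` cannot have distinct conjugates in the `8δ`-ball
  set M := (hball (8 * δ)).toFinset.card with hM
  have hpow : ∀ n : ℕ, d 1 (g ^ n) ≤ n * d 1 g := by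
    intro n
    induction n with
    | zero => simp [hd]
    | succ n ih =>
      have h1 := htri 1 (g ^ n) (g ^ n * g)
      have h2 : d (g ^ n) (g ^ n * g) = d 1 g := by simpa using hinv (g ^ n) 1 g
      rw [pow_succ]
      calc _ ≤ _ := h1
        _ ≤ _ := by rw [h2]; linarith
  refine ⟨{x | d 1 x ≤ 2 * (M * d 1 g + 2 * δ) + 2}, hball _, fun x hx => ?_⟩
  -- a shortest element of the coset
  obtain ⟨k, hk⟩ : ∃ k : ℤ, ∀ l : ℤ, d 1 (x * g ^ k) ≤ d 1 (x * g ^ l) := by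
    obtain ⟨k, hk⟩ := exists_minimalFor_of_wellFoundedLT (fun _ : ℤ => True)
      (fun k => d 1 (x * g ^ k)) ⟨0, trivial⟩
    exact ⟨k, fun l => (le_total _ _).elim id (fun h => hk.2 trivial h)⟩
  refine ⟨k, ?_⟩
  set X := x * g ^ k with hX
  have hXg : Commute X g := hx.mul_left ((Commute.refl g).zpow_left k)
  have hmin : ∀ l : ℤ, d 1 X ≤ d 1 (X * g ^ l) := fun l => by
    rw [hX, mul_assoc, ← zpow_add]; exact hk _
  set L := d 1 X with hL
  by_contra hlong
  simp only [Set.mem_ofPred_eq, not_le] at hlong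
  obtain ⟨s, hs1, hs2⟩ : ∃ s, M * d 1 g + 2 * δ ≤ s ∧ M * d 1 g + 2 * δ ≤ L - s ∧ s ≤ L :=
    ⟨M * d 1 g + 2 * δ, le_rfl, by omega, by omega⟩
  obtain ⟨y, hy1, hy2⟩ := hconn.exists_dist_eq 1 X (s := s) hs2.2
  have hclose : ∀ n : ℕ, n ≤ M → d 1 (y⁻¹ * g ^ n * y) ≤ 8 * δ := by
    intro n hn
    have hD : d 1 (g ^ n) ≤ M * d 1 g := (hpow n).trans (Nat.mul_le_mul_right _ hn)
    have hcn : g ^ n * X = X * g ^ n := (hXg.pow_right n).symm.eq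
    have e1 : d (g ^ n) (g ^ n * X) = L := by simpa using hinv (g ^ n) 1 X
    have e2 : d X (g ^ n * X) = d 1 (g ^ n) := by rw [hcn]; simpa using hinv X 1 (g ^ n)
    have e3 : d (g ^ n) (g ^ n * y) = s := by
      have := hinv (g ^ n) 1 y
      rw [mul_one] at this
      exact this.trans hy1
    have e4 : d (g ^ n * y) (g ^ n * X) = L - s := by rw [hinv]; exact hy2
    have e5 : L ≤ d 1 (g ^ n * X) := by rw [hcn]; exact_mod_cast hmin n
    have e6 : L ≤ d (g ^ n) X := by
      have := hmin (-n)
      rwa [← hinv (g ^ n) 1 (X * g ^ (-n : ℤ)), mul_one, (hXg.zpow_right (-n : ℤ)).eq,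
        zpow_neg, zpow_natCast, mul_inv_cancel_left] at this
    have e7 : d 1 (y⁻¹ * g ^ n * y) = d y (g ^ n * y) := by
      simpa [mul_assoc] using (hinv y 1 (y⁻¹ * g ^ n * y)).symm
    -- `f1` bounds `d 1 (g ^ n * X)` by `L + 2δ`, since the distance from `1` to the coset is `L`;
    -- then `y` and `g ^ n * y` both nearly lie on a geodesic from `g ^ n * X` back to `1`, at the
    -- same distance `L - s` from `g ^ n * X`
    have f1 := hδ 1 (g ^ n * X) X (g ^ n)
    have f2 := hδ y (g ^ n * X) 1 X
    have f3 := hδ (g ^ n * y) 1 (g ^ n) (g ^ n * X)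
    have f4 := hδ y (g ^ n * y) 1 (g ^ n * X)
    have f5 := hδ 1 (g ^ n * y) (g ^ n) (g ^ n * X)
    have t1 := htri 1 y (g ^ n * X)
    have t2 := htri y 1 (g ^ n)
    have c1 := hcomm y 1
    have c2 := hcomm (g ^ n * X) X
    have c3 := hcomm (g ^ n * y) 1
    have c4 := hcomm (g ^ n) 1
    have c5 := hcomm (g ^ n * X) 1
    have c6 := hcomm (g ^ n * y) (g ^ n)
    have c7 := hcomm X (g ^ n)
    have c8 := hcomm (g ^ n * X) (g ^ n)
    have hy1' : d 1 y = s := hy1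
    have hy2' : d y X = L - s := hy2
    rw [e7]
    omega
  -- pigeonhole on the first `M + 1` powers
  have hcard : (hball (8 * δ)).toFinset.card < (Finset.range (M + 1)).card := by simp [hM]
  obtain ⟨i, hi, j, hj, hij, heq⟩ := Finset.exists_ne_map_eq_of_card_lt_of_maps_to hcard
    (f := fun n => y⁻¹ * g ^ n * y) (fun n hn => by
      simpa using hclose n (by simpa [Nat.lt_succ_iff] using hn))
  have hgij : g ^ i = g ^ j := by simpa using heq
  exact hij (injective_pow_iff_not_isOfFinOrder.2 hg hgij)

/-- Torsion-free hyperbolic groups are commutative-transitive. The centralizer of `g` has finitely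
many commutators, hence by Schur's theorem a finite commutator subgroup, which torsion-freeness
makes trivial. -/
theorem commute_of_commute {Γ : Type*} [Group Γ] (h : IsGromovHyperbolic Γ)
    (htf : ∀ g : Γ, g ≠ 1 → ¬ IsOfFinOrder g) {g x y : Γ} (hg : g ≠ 1)
    (hx : Commute x g) (hy : Commute y g) : Commute x y := by
  obtain ⟨F, hF, hFg⟩ := h.exists_finite_centralizer_transversal (htf g hg)
  have hmem : ∀ {z : Γ}, z ∈ Subgroup.centralizer {g} ↔ Commute z g :=
    fun {z} => Subgroup.mem_centralizer_singleton_iff.trans Iff.rfl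
  have hcs : (commutatorSet (Subgroup.centralizer {g})).Finite := by
    refine Set.Finite.of_finite_image (f := Subtype.val) ?_ Subtype.val_injective.injOn
    refine (hF.image2 (fun a b => ⁅a, b⁆) hF).subset ?_
    rintro _ ⟨_, ⟨⟨a, ha⟩, ⟨b, hb⟩, rfl⟩, rfl⟩
    rw [hmem] at ha hb
    obtain ⟨k, hk⟩ := hFg a ha
    obtain ⟨l, hl⟩ := hFg b hb
    refine ⟨_, hk, _, hl, ?_⟩
    have h1 : g ^ k * b = b * g ^ k := ((hb.zpow_right k).eq).symm
    have h2 : g ^ l * a⁻¹ = a⁻¹ * g ^ l := ((ha.inv_left.zpow_right l).eq).symm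
    have h3 : g ^ k * g ^ l = g ^ l * g ^ k := ((Commute.refl g).zpow_zpow k l).eq
    simp only [commutatorElement_def, mul_inv_rev, Subgroup.coe_mul, InvMemClass.coe_inv]
    calc a * g ^ k * (b * g ^ l) * ((g ^ k)⁻¹ * a⁻¹) * ((g ^ l)⁻¹ * b⁻¹)
        = a * (g ^ k * b) * g ^ l * (g ^ k)⁻¹ * a⁻¹ * (g ^ l)⁻¹ * b⁻¹ := by group
      _ = a * b * (g ^ k * g ^ l) * (g ^ k)⁻¹ * a⁻¹ * (g ^ l)⁻¹ * b⁻¹ := by rw [h1]; group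
      _ = a * b * (g ^ l * a⁻¹) * (g ^ l)⁻¹ * b⁻¹ := by rw [h3]; group
      _ = a * b * a⁻¹ * b⁻¹ := by rw [h2]; group
  have := hcs.to_subtype
  let x' : Subgroup.centralizer {g} := ⟨x, hmem.2 hx⟩
  let y' : Subgroup.centralizer {g} := ⟨y, hmem.2 hy⟩
  have hxy : ⁅x', y'⁆ ∈ commutator (Subgroup.centralizer {g}) :=
    Subgroup.commutator_mem_commutator (Subgroup.mem_top _) (Subgroup.mem_top _)
  have hfo : IsOfFinOrder ⁅x, y⁆ := by
    have h1 := isOfFinOrder_of_finite (⟨_, hxy⟩ : commutator (Subgroup.centralizer {g}))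
    exact MonoidHom.isOfFinOrder ((Subgroup.subtype _).comp (commutator _).subtype) h1
  exact commutatorElement_eq_one_iff_commute.1 (by_contra fun hne => htf _ hne hfo)

/-- Centralizers in torsion-free hyperbolic groups have rank one. -/
theorem exists_zpow_eq_zpow {Γ : Type*} [Group Γ] (h : IsGromovHyperbolic Γ)
    (htf : ∀ g : Γ, g ≠ 1 → ¬ IsOfFinOrder g) {g x : Γ} (hg : g ≠ 1) (hx : Commute x g) :
    ∃ k l : ℤ, k ≠ 0 ∧ x ^ k = g ^ l := by
  obtain ⟨F, hF, hFg⟩ := h.exists_finite_centralizer_transversal (htf g hg)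
  choose f hf using fun i : ℤ => hFg (x ^ i) (hx.zpow_left i)
  obtain ⟨i, -, j, -, hij, heq⟩ := Set.infinite_univ.exists_ne_map_eq_of_mapsTo
    (f := fun i => x ^ i * g ^ f i) (fun i _ => hf i) hF
  refine ⟨i - j, f j - f i, sub_ne_zero.2 hij, ?_⟩
  have h1 : x ^ i = x ^ j * g ^ f j * (g ^ f i)⁻¹ := eq_mul_inv_of_mul_eq heq
  have := (((hx.zpow_left j).zpow_right (f j)).mul_right
    ((hx.zpow_left j).zpow_right (f i)).inv_right).eq
  rw [zpow_sub, zpow_sub, h1, mul_assoc (x ^ j), this, mul_inv_cancel_right]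

/-- A torsion-free hyperbolic group with a nontrivial abelian normal subgroup is metabelian: by
`exists_zpow_eq_zpow` each element conjugates a power of `g` to a power of `g`, so
commutators commute with some power of `g`. -/
theorem commute_commutator_of_conj_commute {Γ : Type*} [Group Γ] (h : IsGromovHyperbolic Γ)
    (htf : ∀ g : Γ, g ≠ 1 → ¬ IsOfFinOrder g) {g : Γ} (hg : g ≠ 1)
    (hconj : ∀ h, Commute (h * g * h⁻¹) g) :
    ∀ x ∈ commutator Γ, ∀ y ∈ commutator Γ, Commute x y := by
  have hle : commutator Γ ≤ Subgroup.centralizer {g} := by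
    rw [commutator_def, Subgroup.commutator_le]
    rintro a - b -
    obtain ⟨k, l, hk, hkl⟩ := h.exists_zpow_eq_zpow htf hg (hconj a⁻¹)
    obtain ⟨k', l', hk', hkl'⟩ := h.exists_zpow_eq_zpow htf hg (hconj b⁻¹)
    simp only [inv_inv] at hkl hkl'
    have hz : ∀ (u : Γ) (k l : ℤ), (u⁻¹ * g * u) ^ k = g ^ l ↔ g ^ k * u = u * g ^ l := by
      intro u k l
      have : (u⁻¹ * g * u) ^ k = u⁻¹ * g ^ k * u := by
        simpa only [inv_inv] using conj_zpow (i := k) (a := u⁻¹) (b := g)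
      rw [this, mul_assoc, inv_mul_eq_iff_eq_mul]
    rw [hz] at hkl hkl'
    have hmul : ∀ {u : Γ} {k l : ℤ}, g ^ k * u = u * g ^ l → ∀ n : ℤ,
        g ^ (k * n) * u = u * g ^ (l * n) := by
      intro u k l hu n
      have h1 : SemiconjBy u (g ^ l) (g ^ k) := hu.symm
      simpa [SemiconjBy, zpow_mul] using (h1.zpow_right n).eq.symm
    have e1 := hmul hkl k'
    have e2 := hmul hkl' l
    have e3 := hmul hkl' k
    have e4 := hmul hkl l'
    have eab : g ^ (k * k') * (a * b) = a * b * g ^ (l * l') := by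
      rw [← mul_assoc, e1, mul_assoc, mul_comm l k', e2, mul_comm l' l, mul_assoc]
    have eba : g ^ (k * k') * (b * a) = b * a * g ^ (l * l') := by
      rw [← mul_assoc, mul_comm k k', e3, mul_assoc, mul_comm l' k, e4, mul_assoc]
    have hcomm : Commute ⁅a, b⁆ (g ^ (k * k')) := by
      have h1 : SemiconjBy (a * b) (g ^ (l * l')) (g ^ (k * k')) := eab.symm
      have h2 : SemiconjBy (b * a) (g ^ (l * l')) (g ^ (k * k')) := eba.symm
      have h3 := h1.mul_left h2.inv_symm_left
      have h4 : ⁅a, b⁆ = a * b * (b * a)⁻¹ := by simp [commutatorElement_def, mul_assoc]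
      rw [h4]; exact h3
    have hne : g ^ (k * k') ≠ 1 := fun h1 => htf g hg
      (isOfFinOrder_iff_zpow_eq_one.2 ⟨_, mul_ne_zero hk hk', h1⟩)
    exact Subgroup.mem_centralizer_singleton_iff.2
      (h.commute_of_commute htf hne hcomm ((Commute.refl g).zpow_right _)).eq
  exact fun x hx y hy => h.commute_of_commute htf hg
    (Subgroup.mem_centralizer_singleton_iff.1 (hle hx))
    (Subgroup.mem_centralizer_singleton_iff.1 (hle hy))

end IsGromovHyperbolic

/-! ### Free products -/

namespace Monoid.CoprodI

/-- The segment of length `n` starting at position `k` of an infinite word. -/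
def segment {α : Type*} (W : ℕ → α) (k n : ℕ) : List α := (List.range' k n).map W

theorem segment_add {α : Type*} (W : ℕ → α) (k m n : ℕ) :
    segment W k (m + n) = segment W k m ++ segment W (k + m) n := by
  rw [segment, segment, segment, ← List.map_append]
  congr 1
  simp

@[simp]
theorem length_segment {α : Type*} (W : ℕ → α) (k n : ℕ) : (segment W k n).length = n := by
  simp [segment]

theorem take_segment {α : Type*} (W : ℕ → α) {k m n : ℕ} (h : m ≤ n) :
    (segment W k n).take m = segment W k m := by
  obtain ⟨p, rfl⟩ := Nat.exists_eq_add_of_le h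
  rw [segment_add, List.take_left' (length_segment _ _ _)]

theorem drop_segment {α : Type*} (W : ℕ → α) (k m n : ℕ) :
    (segment W k (m + n)).drop m = segment W (k + m) n := by
  rw [segment_add, List.drop_left' (length_segment _ _ _)]

variable {ι : Type*} {G : ι → Type*} [∀ i, Group (G i)]

/-- A list of letters is reduced if it contains no trivial letter and no two adjacent letters come
from the same factor. -/
def IsReduced (l : List (Σ i, G i)) : Prop :=
  (∀ s ∈ l, s.2 ≠ 1) ∧ l.IsChain (fun s s' => s.1 ≠ s'.1)

/-- The element of the free product spelled by a list of letters. -/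
def listProd (l : List (Σ i, G i)) : CoprodI G :=
  (l.map fun s => of s.2).prod

@[simp]
theorem listProd_nil : listProd ([] : List (Σ i, G i)) = 1 := rfl

@[simp]
theorem listProd_cons (s : Σ i, G i) (l : List (Σ i, G i)) :
    listProd (s :: l) = of s.2 * listProd l := by
  simp [listProd]

@[simp]
theorem listProd_append (l l' : List (Σ i, G i)) :
    listProd (l ++ l') = listProd l * listProd l' := by
  simp [listProd]

theorem IsReduced.eq_of_listProd_eq {l l' : List (Σ i, G i)} (h : IsReduced l) (h' : IsReduced l')
    (heq : listProd l = listProd l') : l = l' := by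
  classical
  have : (⟨l, h.1, h.2⟩ : Word G) = ⟨l', h'.1, h'.2⟩ := Word.equiv.symm.injective heq
  exact congrArg Word.toList this

theorem exists_isReduced (x : CoprodI G) : ∃ l, IsReduced l ∧ listProd l = x := by
  classical
  exact ⟨(Word.equiv x).toList, ⟨(Word.equiv x).ne_one, (Word.equiv x).chain_ne⟩,
    Word.equiv.symm_apply_apply x⟩

theorem isReduced_nil : IsReduced ([] : List (Σ i, G i)) := ⟨by simp, List.isChain_nil⟩

theorem isReduced_append {l l' : List (Σ i, G i)} :
    IsReduced (l ++ l') ↔ IsReduced l ∧ IsReduced l' ∧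
      ∀ x ∈ l.getLast?, ∀ y ∈ l'.head?, x.1 ≠ y.1 := by
  simp only [IsReduced, List.isChain_append, List.mem_append, or_imp, forall_and]
  tauto

theorem isReduced_cons {s : Σ i, G i} {l : List (Σ i, G i)} :
    IsReduced (s :: l) ↔ s.2 ≠ 1 ∧ IsReduced l ∧ ∀ y ∈ l.head?, s.1 ≠ y.1 := by
  simp only [IsReduced, List.isChain_cons, List.mem_cons, forall_eq_or_imp]
  tauto

theorem isReduced_singleton {s : Σ i, G i} : IsReduced [s] ↔ s.2 ≠ 1 := by
  simp [isReduced_cons, isReduced_nil]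

/-- The formal inverse of a list of letters. -/
def listInv (l : List (Σ i, G i)) : List (Σ i, G i) :=
  (l.map fun s => (⟨s.1, s.2⁻¹⟩ : Σ i, G i)).reverse

theorem listProd_listInv (l : List (Σ i, G i)) : listProd (listInv l) = (listProd l)⁻¹ := by
  induction l with
  | nil => simp [listInv]
  | cons s l ih =>
    simp only [listInv, List.map_cons, List.reverse_cons, listProd_append, listProd_cons,
      mul_inv_rev, listProd_nil, mul_one, map_inv] at ih ⊢
    rw [ih]

theorem isReduced_listInv {l : List (Σ i, G i)} (h : IsReduced l) : IsReduced (listInv l) := by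
  refine ⟨?_, ?_⟩
  · intro s hs
    simp only [listInv, List.mem_reverse, List.mem_map] at hs
    obtain ⟨s, hs, rfl⟩ := hs
    simpa using h.1 s hs
  · simp only [listInv, List.isChain_reverse, List.isChain_map]
    exact h.2.imp fun _ _ h => h.symm

/-- Multiplying by `x` on the left changes only a prefix of a reduced word, of length at most the
length of `x`. -/
theorem exists_listProd_append_drop (x : List (Σ i, G i)) {U : List (Σ i, G i)}
    (hU : IsReduced U) :
    ∃ V, IsReduced (V ++ U.drop x.length) ∧
      listProd x * listProd U = listProd (V ++ U.drop x.length) := by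
  classical
  induction x with
  | nil => exact ⟨[], by simpa using hU, by simp⟩
  | cons s x ih =>
    obtain ⟨V, hV, hVp⟩ := ih
    rw [listProd_cons, mul_assoc, hVp, List.length_cons]
    -- move the first letter of the unchanged suffix into the prefix
    obtain ⟨V₁, hV₁⟩ : ∃ V₁, V ++ U.drop x.length = V₁ ++ U.drop (x.length + 1) :=
      ⟨V ++ (U.drop x.length).take 1, by
        rw [List.append_assoc, ← List.drop_drop, List.take_append_drop]⟩
    have hnil : V₁ = [] → U.drop (x.length + 1) = [] ∧ V ++ U.drop x.length = [] := by
      rintro rfl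
      have h1 := congrArg List.length hV₁
      simp only [List.length_append, List.length_drop, List.length_nil] at h1
      have h2 : U.length ≤ x.length := by omega
      refine ⟨List.drop_eq_nil_of_le (by omega), ?_⟩
      rw [hV₁, List.nil_append]
      exact List.drop_eq_nil_of_le (by omega)
    rw [hV₁] at hV ⊢
    by_cases hs : s.2 = 1
    · exact ⟨V₁, hV, by simp [hs]⟩
    cases V₁ with
    | nil =>
      refine ⟨[s], ?_, by simp⟩
      rw [(hnil rfl).1]
      exact isReduced_singleton.2 hs
    | cons v V₂ =>
      rw [List.cons_append, isReduced_cons] at hV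
      by_cases hsv : s.1 = v.1
      · obtain ⟨i, a⟩ := s
        obtain ⟨j, b⟩ := v
        obtain rfl : i = j := hsv
        by_cases hab : a * b = 1
        · refine ⟨V₂, hV.2.1, ?_⟩
          have : of a * of b = (1 : CoprodI G) := by rw [← map_mul, hab, map_one]
          simp only [List.cons_append, listProd_cons]
          rw [← mul_assoc, this, one_mul]
        · refine ⟨⟨i, a * b⟩ :: V₂, ?_, by simp [mul_assoc]⟩
          rw [List.cons_append, isReduced_cons]
          exact ⟨hab, hV.2⟩
      · refine ⟨s :: v :: V₂, ?_, by simp⟩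
        rw [List.cons_append, isReduced_cons, List.cons_append, isReduced_cons]
        refine ⟨hs, hV, ?_⟩
        simpa using hsv

/-- Multiplying by `y` on the right changes only a suffix of a reduced word, of length at most the
length of `y`. -/
theorem exists_listProd_take_append (y : List (Σ i, G i)) {U : List (Σ i, G i)}
    (hU : IsReduced U) :
    ∃ V, IsReduced (U.take (U.length - y.length) ++ V) ∧
      listProd U * listProd y = listProd (U.take (U.length - y.length) ++ V) := by
  obtain ⟨V, hV, hVp⟩ := exists_listProd_append_drop (listInv y) (isReduced_listInv hU)
  have key : listInv (V ++ (listInv U).drop (listInv y).length) =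
      U.take (U.length - y.length) ++ listInv V := by
    simp [listInv, List.drop_reverse, ← List.map_take, Function.comp_def]
  refine ⟨listInv V, ?_, ?_⟩
  · rw [← key]; exact isReduced_listInv hV
  · rw [← key, listProd_listInv, ← hVp, listProd_listInv, listProd_listInv]
    simp

theorem isReduced_segment {W : ℕ → Σ i, G i} (hW : ∀ k, (W k).2 ≠ 1)
    (hW' : ∀ k, (W k).1 ≠ (W (k + 1)).1) (k n : ℕ) : IsReduced (segment W k n) := by
  induction n generalizing k with
  | zero => exact isReduced_nil
  | succ n ih =>
    have : segment W k (n + 1) = W k :: segment W (k + 1) n := by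
      simp [segment, List.range'_succ]
    rw [this, isReduced_cons]
    refine ⟨hW k, ih _, ?_⟩
    cases n with
    | zero => simp [segment]
    | succ n => simpa [segment, List.range'_succ] using hW' k

/-- An element commuting with the period of a periodic reduced infinite word shifts the
prefixes of that word. -/
theorem exists_shift_of_commute {W : ℕ → Σ i, G i} (hW : ∀ k, (W k).2 ≠ 1)
    (hW' : ∀ k, (W k).1 ≠ (W (k + 1)).1) {r : ℕ} (hr : 0 < r) (hper : ∀ k, W (k + r) = W k)
    {x : CoprodI G} (hx : Commute x (listProd (segment W 0 r))) :
    ∃ a b, ∀ k, x * listProd (segment W 0 (a + k)) = listProd (segment W 0 (b + k)) := by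
  set z := listProd (segment W 0 r) with hz
  have hperseg : ∀ n, segment W r n = segment W 0 n := by
    intro n
    rw [segment, segment, List.range'_eq_map_range, List.range'_eq_map_range, List.map_map,
      List.map_map]
    refine List.map_congr_left fun k _ => ?_
    simp [add_comm r k, hper]
  have hpow : ∀ n k, listProd (segment W 0 (r * n + k)) = z ^ n * listProd (segment W 0 k) := by
    intro n k
    induction n with
    | zero => simp
    | succ n ih =>
      rw [show r * (n + 1) + k = r + (r * n + k) by ring, segment_add, listProd_append, zero_add,
        hperseg, ih, pow_succ', mul_assoc]
  obtain ⟨l, -, rfl⟩ := exists_isReduced x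
  obtain ⟨V, hV, hVp⟩ := exists_listProd_append_drop l
    (isReduced_segment hW hW' 0 (l.length + 1))
  rw [drop_segment, zero_add] at hV hVp
  -- the reduced word of `x` times a long prefix
  have hVk : ∀ k, IsReduced (V ++ segment W l.length (1 + k)) ∧
      listProd l * listProd (segment W 0 (l.length + 1 + k)) =
        listProd (V ++ segment W l.length (1 + k)) := by
    intro k
    have hred := isReduced_segment hW hW' l.length (1 + k)
    rw [segment_add, ← List.append_assoc]
    constructor
    · rw [segment_add, isReduced_append] at hred
      rw [isReduced_append]
      refine ⟨hV, hred.2.1, ?_⟩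
      rw [List.getLast?_append]
      simpa [segment] using hred.2.2
    · rw [segment_add, listProd_append, ← mul_assoc, hVp, zero_add, ← listProd_append]
  refine ⟨l.length + 1, V.length + 1, fun k => ?_⟩
  obtain ⟨hred, hprod⟩ := hVk k
  set Vk := V ++ segment W l.length (1 + k) with hVkdef
  have hlen : Vk.length = V.length + 1 + k := by simp [hVkdef]; omega
  -- `x` also equals `z ^ n * x * z ^ (-n)`, so for large `n` the word `Vk` is a prefix of `W`
  set n := 2 * Vk.length with hn
  obtain ⟨V', hV', hVp'⟩ := exists_listProd_take_append Vk (isReduced_segment hW hW' 0 (r * n))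
  have hrn : 2 * Vk.length ≤ r * n := by rw [hn]; exact Nat.le_mul_of_pos_left _ hr
  rw [length_segment, take_segment _ (Nat.sub_le _ _)] at hV' hVp'
  obtain ⟨hred2, hprod2⟩ := hVk (k + r * n)
  have heq : listProd (V ++ segment W l.length (1 + (k + r * n))) =
      listProd (segment W 0 (r * n - Vk.length) ++ V') := by
    have hw := hpow n 0
    rw [add_zero] at hw
    rw [← hprod2, ← hVp', hw, show l.length + 1 + (k + r * n) = r * n + (l.length + 1 + k) by ring,
      hpow, ← hprod, ← mul_assoc, (hx.pow_right n).eq]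
    simp [segment, mul_assoc]
  have hlist := congrArg (List.take Vk.length) (hred2.eq_of_listProd_eq hV' heq)
  rw [← add_assoc, segment_add, ← List.append_assoc, ← hVkdef, List.take_left' rfl,
    List.take_append_of_le_length (by rw [length_segment]; omega),
    take_segment _ (by omega)] at hlist
  rw [hprod, ← hlen, ← hlist]

/-- The centralizer of a cyclically reduced element of length at least two is commutative: its
elements act as shifts on the infinite word repeating that element. -/
theorem commute_of_cyclically_reduced {l : List (Σ i, G i)} (hne : l ≠ []) (hl : IsReduced (l ++ l))
    {x y : CoprodI G} (hx : Commute x (listProd l)) (hy : Commute y (listProd l)) :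
    Commute x y := by
  have hr : 0 < l.length := List.length_pos_iff.2 hne
  let W : ℕ → Σ i, G i := fun k => l[k % l.length]'(Nat.mod_lt _ hr)
  have hseg : segment W 0 l.length = l := by
    refine List.ext_getElem (by simp) fun k h1 h2 => ?_
    simp [segment, W, Nat.mod_eq_of_lt h2]
  have hW : ∀ k, (W k).2 ≠ 1 := fun k => hl.1 _ (by simp [W])
  have hW' : ∀ k, (W k).1 ≠ (W (k + 1)).1 := by
    intro k
    have hlt : k % l.length < l.length := Nat.mod_lt _ hr
    have h1 := (List.isChain_iff_getElem.1 hl.2) (k % l.length) (by simp; omega)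
    have h2 : (l ++ l)[k % l.length]'(by simp; omega) = W k := by
      simp [W, hlt]
    have h3 : (l ++ l)[k % l.length + 1]'(by simp; omega) = W (k + 1) := by
      by_cases h : k % l.length + 1 < l.length
      · have : (k + 1) % l.length = k % l.length + 1 := by
          rw [Nat.add_mod, Nat.mod_eq_of_lt (a := 1) (by omega), Nat.mod_eq_of_lt h]
        simp [W, h, this]
      · have h4 : k % l.length + 1 = l.length := by omega
        have : (k + 1) % l.length = 0 := by
          rw [← Nat.mod_add_mod, h4, Nat.mod_self]
        simp [W, h4, this]
    rw [h2, h3] at h1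
    exact h1
  have hper : ∀ k, W (k + l.length) = W k := fun k => by simp [W]
  rw [← hseg] at hx hy
  obtain ⟨a, b, h⟩ := exists_shift_of_commute hW hW' hr hper hx
  obtain ⟨a', b', h'⟩ := exists_shift_of_commute hW hW' hr hper hy
  have e1 : x * y * listProd (segment W 0 (a + a')) = listProd (segment W 0 (b + b')) := by
    rw [add_comm a, mul_assoc, h', add_comm b', h]
  have e2 : y * x * listProd (segment W 0 (a + a')) = listProd (segment W 0 (b + b')) := by
    rw [mul_assoc, h, add_comm, h', add_comm]
  exact mul_right_cancel (e1.trans e2.symm)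

/-- Every element of a free product is conjugate into a factor or to a cyclically reduced word. -/
theorem exists_conj_eq_of_or_cyclically_reduced [Nonempty ι] (l : List (Σ i, G i))
    (hl : IsReduced l) :
    ∃ g : CoprodI G, (∃ (i : ι) (m : G i), listProd l = g * of m * g⁻¹) ∨
      ∃ l', l' ≠ [] ∧ IsReduced (l' ++ l') ∧ listProd l = g * listProd l' * g⁻¹ := by
  induction hn : l.length using Nat.strong_induction_on generalizing l with
  | _ n ih =>
    subst hn
    rcases l with _ | ⟨a, t⟩
    · exact ⟨1, Or.inl ⟨Classical.arbitrary ι, 1, by simp⟩⟩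
    rcases List.eq_nil_or_concat t with rfl | ⟨mid, b, rfl⟩
    · exact ⟨1, Or.inl ⟨a.1, a.2, by simp⟩⟩
    simp only [List.concat_eq_append] at hl ih ⊢
    by_cases hab : a.1 = b.1
    · obtain ⟨i, a⟩ := a
      obtain ⟨j, b⟩ := b
      obtain rfl : i = j := hab
      rw [isReduced_cons, isReduced_append] at hl
      have hred : ∀ l', IsReduced l' → l'.length < mid.length + 2 →
          listProd (⟨i, a⟩ :: (mid ++ [⟨i, b⟩])) = of a * listProd l' * (of a)⁻¹ →
          ∃ g : CoprodI G, (∃ (k : ι) (m : G k),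
            listProd (⟨i, a⟩ :: (mid ++ [⟨i, b⟩])) = g * of m * g⁻¹) ∨
            ∃ l', l' ≠ [] ∧ IsReduced (l' ++ l') ∧
              listProd (⟨i, a⟩ :: (mid ++ [⟨i, b⟩])) = g * listProd l' * g⁻¹ := by
        intro l' hl' hlen heq
        obtain ⟨g, ⟨k, m, h⟩ | ⟨l'', h1, h2, h⟩⟩ := ih l'.length
          (by simp only [List.length_cons, List.length_append, List.length_nil]; omega) l' hl' rfl
        · exact ⟨of a * g, Or.inl ⟨k, m, by rw [heq, h]; group⟩⟩
        · exact ⟨of a * g, Or.inr ⟨l'', h1, h2, by rw [heq, h]; group⟩⟩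
      by_cases hba : b * a = 1
      · refine hred mid hl.2.1.1 (by omega) ?_
        rw [eq_inv_of_mul_eq_one_left hba]
        simp [mul_assoc]
      · refine hred (mid ++ [⟨i, b * a⟩]) ?_ (by simp) (by simp [mul_assoc])
        rw [isReduced_append, isReduced_singleton]
        exact ⟨hl.2.1.1, hba, by simpa using hl.2.1.2.2⟩
    · refine ⟨1, Or.inr ⟨a :: (mid ++ [b]), by simp, ?_, by simp⟩⟩
      rw [isReduced_append]
      refine ⟨hl, hl, ?_⟩
      rw [← List.cons_append, List.getLast?_append]
      simpa using fun h => hab h.symm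

/-- An element outside the factor `G i` becomes, after stripping letters of `G i` at both ends, a
reduced word neither beginning nor ending in `G i`. -/
theorem exists_mul_listProd_mul (i : ι) (x : CoprodI G) :
    x ∈ (of : G i →* CoprodI G).range ∨ ∃ (a b : G i) (l : List (Σ i, G i)),
      x = of a * listProd l * of b ∧ l ≠ [] ∧ IsReduced l ∧ (∀ s ∈ l.head?, s.1 ≠ i) ∧
      ∀ s ∈ l.getLast?, s.1 ≠ i := by
  obtain ⟨l, hl, rfl⟩ := exists_isReduced x
  obtain ⟨a, l', hl', heq, hhead⟩ : ∃ (a : G i) (l' : List (Σ i, G i)), IsReduced l' ∧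
      listProd l = of a * listProd l' ∧ ∀ s ∈ l'.head?, s.1 ≠ i := by
    rcases l with _ | ⟨⟨j, a⟩, l'⟩
    · exact ⟨1, [], isReduced_nil, by simp, by simp⟩
    by_cases hji : j = i
    · subst hji
      rw [isReduced_cons] at hl
      exact ⟨a, l', hl.2.1, by simp, fun s hs => (hl.2.2 s hs).symm⟩
    · exact ⟨1, _, hl, by simp, by simpa using hji⟩
  rcases List.eq_nil_or_concat l' with rfl | ⟨mid, ⟨j, b⟩, rfl⟩
  · exact Or.inl ⟨a, by simp [heq]⟩
  rw [List.concat_eq_append] at hl' heq hhead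
  right
  by_cases hji : j = i
  · subst hji
    have hmid : mid ≠ [] := by
      rintro rfl
      simp at hhead
    rw [isReduced_append] at hl'
    refine ⟨a, b, mid, by simp [heq, mul_assoc], hmid, hl'.1, ?_, ?_⟩
    · rwa [List.head?_append_of_ne_nil _ hmid] at hhead
    · simpa using hl'.2.2
  · exact ⟨a, 1, _, by simp [heq], by simp, hl', hhead, by simpa using hji⟩

/-- The centralizer of a nontrivial element of a factor lies in that factor. -/
theorem mem_range_of_commute_of {i : ι} {m : G i} (hm : m ≠ 1) {x : CoprodI G}
    (hx : Commute x (of m)) : x ∈ (of : G i →* CoprodI G).range := by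
  refine (exists_mul_listProd_mul i x).resolve_right ?_
  rintro ⟨a, b, l, rfl, hne, hl, hhead, hlast⟩
  have heq : listProd (⟨i, a⁻¹ * m * a⟩ :: l) = listProd (l ++ [⟨i, b * m * b⁻¹⟩]) := by
    have h := hx.eq
    simp only [listProd_cons, listProd_append, listProd_nil, mul_one, map_mul, map_inv]
    calc _ = (of a)⁻¹ * (of m * (of a * listProd l * of b)) * (of b)⁻¹ := by group
      _ = _ := by rw [← h]; group
  have h1 : IsReduced (⟨i, a⁻¹ * m * a⟩ :: l) := by
    rw [isReduced_cons]
    refine ⟨fun h => hm ?_, hl, fun s hs => (hhead s hs).symm⟩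
    simpa using (conj_eq_one_iff (a := a⁻¹) (b := m)).1 (by simpa using h)
  have h2 : IsReduced (l ++ [⟨i, b * m * b⁻¹⟩]) := by
    rw [isReduced_append, isReduced_singleton]
    exact ⟨hl, fun h => hm (conj_eq_one_iff.1 h), by simpa using hlast⟩
  have h3 := congrArg List.head? (h1.eq_of_listProd_eq h2 heq)
  rw [List.head?_append_of_ne_nil _ hne] at h3
  exact hhead _ h3.symm rfl

/-- In a free product, a centralizer is commutative or conjugate to a centralizer taken inside one
of the factors. -/
theorem centralizer_commutative_or_conj_of [Nonempty ι] {z : CoprodI G} (hz : z ≠ 1) :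
    (∀ x y, Commute x z → Commute y z → Commute x y) ∨
      ∃ (g : CoprodI G) (i : ι) (m : G i), m ≠ 1 ∧ z = g * of m * g⁻¹ ∧
        ∀ x, Commute x z → ∃ y : G i, Commute y m ∧ x = g * of y * g⁻¹ := by
  obtain ⟨l, hl, rfl⟩ := exists_isReduced z
  have hconj : ∀ {g x w : CoprodI G}, Commute x (g * w * g⁻¹) ↔ Commute (g⁻¹ * x * g) w := by
    intro g x w
    rw [← Commute.conj_iff g⁻¹]
    simp [mul_assoc]
  obtain ⟨g, ⟨i, m, h⟩ | ⟨l', h1, h2, h⟩⟩ := exists_conj_eq_of_or_cyclically_reduced l hl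
  · right
    have hm : m ≠ 1 := by
      rintro rfl
      simp [h] at hz
    refine ⟨g, i, m, hm, h, fun x hx => ?_⟩
    rw [h, hconj] at hx
    obtain ⟨y, hy⟩ := mem_range_of_commute_of hm hx
    refine ⟨y, ?_, by rw [hy]; group⟩
    rw [← hy] at hx
    classical
    exact of_injective i (by simpa using hx.eq)
  · left
    intro x y hx hy
    rw [h, hconj] at hx hy
    have := commute_of_cyclically_reduced h1 h2 hx hy
    simpa [mul_assoc] using (Commute.conj_iff g).2 this

/-- If the factor `G i` has at least three elements, every nontrivial element of the free product
has a conjugate whose reduced word begins and ends in `G i`. -/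
theorem exists_conj_eq_neWord_prod {i : ι} (hi : ∀ m : G i, ∃ p : G i, p ≠ 1 ∧ p ≠ m)
    {u : CoprodI G} (hu : u ≠ 1) :
    ∃ (g : CoprodI G) (w : NeWord G i i), w.prod = g * u * g⁻¹ := by
  classical
  have hfst : ∀ {j : ι} (w : NeWord G i j), i ≠ j →
      ∃ (g : CoprodI G) (w' : NeWord G i i), w'.prod = g * w.prod * g⁻¹ := by
    intro j w hij
    obtain ⟨p, hp, hp'⟩ := hi w.head⁻¹
    have hne : p * w.head ≠ 1 := fun h => hp' (eq_inv_of_mul_eq_one_left h)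
    exact ⟨of p, (w.mulHead p hne).append hij.symm (.singleton p⁻¹ (inv_ne_one.2 hp)), by simp⟩
  obtain ⟨k, l, w, hw⟩ := NeWord.of_word (Word.equiv u)
    (fun h => hu ((Word.equiv.symm_apply_apply u).symm.trans (congrArg Word.prod h)))
  have hwu : w.prod = u := by
    have := congrArg Word.prod hw
    exact this.trans (Word.equiv.symm_apply_apply u)
  rw [← hwu]
  by_cases hk : i = k
  · subst hk
    by_cases hl : i = l
    · subst hl
      exact ⟨1, w, by simp⟩
    · exact hfst w hl
  · by_cases hl : i = l
    · subst hl
      obtain ⟨g, w', h⟩ := hfst w.inv hk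
      exact ⟨g, w'.inv, by rw [NeWord.inv_prod, h]; simp [mul_assoc]⟩
    · obtain ⟨p, hp, -⟩ := hi 1
      exact ⟨of p, ((NeWord.singleton p hp).append hk w).append (Ne.symm hl)
        (.singleton p⁻¹ (inv_ne_one.2 hp)), by simp⟩

/-- In a free product of two groups with at least three elements each, no two nontrivial elements
have all their conjugates commuting. -/
theorem eq_one_or_eq_one_of_conj_commute {i j : ι} (hij : i ≠ j)
    (hi : ∀ m : G i, ∃ p : G i, p ≠ 1 ∧ p ≠ m) (hj : ∀ m : G j, ∃ p : G j, p ≠ 1 ∧ p ≠ m)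
    {u v : CoprodI G} (h : ∀ g h, Commute (g * u * g⁻¹) (h * v * h⁻¹)) : u = 1 ∨ v = 1 := by
  classical
  by_contra! hne
  obtain ⟨g, w, hw⟩ := exists_conj_eq_neWord_prod hi hne.1
  obtain ⟨g', w', hw'⟩ := exists_conj_eq_neWord_prod hj hne.2
  have hc := (h g g').eq
  rw [← hw, ← hw'] at hc
  have heq : (w.append hij w').toWord = (w'.append hij.symm w).toWord := by
    refine Word.equiv.symm.injective (?_ : (w.append hij w').prod = (w'.append hij.symm w).prod)
    simpa using hc
  have h1 := congrArg (fun w => w.toList.head?) heq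
  simp only [NeWord.toWord, NeWord.toList_head?, Option.some.injEq, Sigma.mk.injEq] at h1
  exact hij h1.1

end Monoid.CoprodI

/-! ### HNN extensions -/

namespace HNNExtension

open NormalWord

variable {G : Type*} [Group G] {A B : Subgroup G} {φ : A ≃* B}

variable (φ) in
/-- The element `t ^ u₁ * g₁ * t ^ u₂ * g₂ * ⋯` of an HNN extension spelled by a list of pairs
`(uᵢ, gᵢ)`. -/
def listProd (l : List (ℤˣ × G)) : HNNExtension G A B φ :=
  (l.map fun x => t ^ (x.1 : ℤ) * of x.2).prod

@[simp]
theorem listProd_nil : listProd φ [] = 1 := rfl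

@[simp]
theorem listProd_cons (x : ℤˣ × G) (l : List (ℤˣ × G)) :
    listProd φ (x :: l) = t ^ (x.1 : ℤ) * of x.2 * listProd φ l := by
  simp [listProd]

@[simp]
theorem listProd_append (l l' : List (ℤˣ × G)) :
    listProd φ (l ++ l') = listProd φ l * listProd φ l' := by
  simp [listProd]

variable (A B) in
/-- A list of pairs is reduced if it contains no pinch `t ^ u * g * t ^ (-u)`. -/
def IsReduced (l : List (ℤˣ × G)) : Prop :=
  l.IsChain fun a b => a.2 ∈ toSubgroup A B a.1 → a.1 = b.1

theorem t_zpow_mul_of_mul_t_zpow_neg (u : ℤˣ) (a : toSubgroup A B u) :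
    (t ^ (u : ℤ) * of (a : G) * t ^ ((-u : ℤˣ) : ℤ) : HNNExtension G A B φ) =
      of (toSubgroupEquiv φ u a : G) := by
  rcases Int.units_eq_one_or u with rfl | rfl
  · simp only [Units.val_one, zpow_one, Units.val_neg, zpow_neg]
    exact (equiv_eq_conj (φ := φ) a).symm
  · simp only [Units.val_one, zpow_one, Units.val_neg, zpow_neg, neg_neg]
    exact (equiv_symm_eq_conj (φ := φ) a).symm

theorem exists_isReduced_cons (u : ℤˣ) (g h : G) {l : List (ℤˣ × G)} (hl : IsReduced A B l) :
    ∃ h' l', IsReduced A B l' ∧ l'.length ≤ l.length + 1 ∧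
      t ^ (u : ℤ) * of g * (of h * listProd φ l) = of h' * listProd φ l' := by
  by_cases hred : IsReduced A B ((u, g * h) :: l)
  · exact ⟨1, _, hred, by simp, by simp [mul_assoc]⟩
  cases l with
  | nil => exact absurd (List.isChain_singleton _) hred
  | cons x l =>
    simp only [IsReduced, List.isChain_cons_cons] at hred hl
    obtain ⟨hmem, hne⟩ : g * h ∈ toSubgroup A B u ∧ u ≠ x.1 := by
      by_contra hcon
      refine hred ⟨fun h1 => ?_, hl⟩
      by_contra h2
      exact hcon ⟨h1, h2⟩
    obtain ⟨v, k⟩ := x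
    obtain rfl : v = -u := by
      rcases Int.units_eq_one_or u with rfl | rfl <;>
      rcases Int.units_eq_one_or v with rfl | rfl <;> simp_all
    have key := t_zpow_mul_of_mul_t_zpow_neg (φ := φ) u ⟨_, hmem⟩
    refine ⟨(toSubgroupEquiv φ u ⟨_, hmem⟩ : G) * k, l, ?_, by simp only [List.length_cons]; omega, ?_⟩
    · exact (List.isChain_cons.1 hl).2
    · rw [map_mul, ← key]
      simp [mul_assoc]

/-- Left multiplication by a word with `k` stable letters lengthens a reduced word by at most
`k`. -/
theorem exists_isReduced_mul (l' : List (ℤˣ × G)) (h : G) {l : List (ℤˣ × G)}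
    (hl : IsReduced A B l) :
    ∃ h₁ l₁, IsReduced A B l₁ ∧ l₁.length ≤ l'.length + l.length ∧
      listProd φ l' * (of h * listProd φ l) = of h₁ * listProd φ l₁ := by
  induction l' with
  | nil => exact ⟨h, l, hl, by simp, by simp⟩
  | cons x l' ih =>
    obtain ⟨h₁, l₁, hl₁, hlen, heq⟩ := ih
    obtain ⟨h₂, l₂, hl₂, hlen', heq'⟩ := exists_isReduced_cons (φ := φ) x.1 x.2 h₁ hl₁
    refine ⟨h₂, l₂, hl₂, by simp; omega, ?_⟩
    rw [listProd_cons, mul_assoc, heq, heq']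

theorem exists_isReduced (x : HNNExtension G A B φ) :
    ∃ h l, IsReduced A B l ∧ x = of h * listProd φ l := by
  obtain ⟨d⟩ := TransversalPair.nonempty G A B
  have := (NormalWord.equiv φ d).symm_apply_apply x
  exact ⟨_, _, (NormalWord.equiv φ d x).chain, this.symm⟩

theorem IsReduced.length_eq {l l' : List (ℤˣ × G)} (hl : IsReduced A B l) (hl' : IsReduced A B l')
    {h h' : G} (heq : of h * listProd φ l = of h' * listProd φ l') : l.length = l'.length := by
  have := (ReducedWord.map_fst_eq_and_of_prod_eq φ (w₁ := ⟨h, l, hl⟩) (w₂ := ⟨h', l', hl'⟩) heq).1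
  simpa using congrArg List.length this

/-- Every element of an HNN extension is conjugate into the base group or to a cyclically reduced
word. -/
theorem exists_conj_eq_of_or_cyclically_reduced (x : HNNExtension G A B φ) :
    ∃ g : HNNExtension G A B φ, (∃ a, x = g * of a * g⁻¹) ∨
      ∃ l, l ≠ [] ∧ IsReduced A B (l ++ l) ∧ x = g * listProd φ l * g⁻¹ := by
  classical
  -- an expression of a conjugate of `x` with the fewest stable letters
  let P : ℕ → Prop := fun n => ∃ (g : HNNExtension G A B φ) (h : G) (l : List (ℤˣ × G)),
    l.length ≤ n ∧ x = g * (of h * listProd φ l) * g⁻¹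
  have hP : ∃ n, P n := by
    obtain ⟨h, l, -, hx⟩ := exists_isReduced x
    exact ⟨l.length, 1, h, l, le_rfl, by simpa using hx⟩
  obtain ⟨g, h, l, hlen, hx⟩ := Nat.find_spec hP
  have hmin := fun n => Nat.find_min' hP (m := n)
  set N := Nat.find hP
  obtain ⟨h₁, l₁, hl₁, hlen₁, heq⟩ :=
    exists_isReduced_mul (φ := φ) l 1 (List.isChain_nil : IsReduced A B [])
  simp only [map_one, listProd_nil, mul_one] at heq
  replace hx : x = g * (of (h * h₁) * listProd φ l₁) * g⁻¹ := by
    rw [hx, heq, map_mul, mul_assoc (of h)]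
  simp only [List.length_nil, add_zero] at hlen₁
  rcases List.eq_nil_or_concat l₁ with rfl | ⟨mid, ⟨u, k⟩, rfl⟩
  · exact ⟨g, Or.inl ⟨h * h₁, by simpa using hx⟩⟩
  simp only [List.concat_eq_append, List.length_append, List.length_singleton] at hl₁ hx hlen₁
  -- absorb the head into the last letter by a conjugation
  set k' := k * (h * h₁) with hk'
  have hx' : x = g * of (h * h₁) * listProd φ (mid ++ [(u, k')]) * (g * of (h * h₁))⁻¹ := by
    rw [hx, hk']
    simp [mul_assoc]
  have hred : IsReduced A B (mid ++ [(u, k')]) := by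
    rw [IsReduced, List.isChain_append] at hl₁ ⊢
    simpa using hl₁
  refine ⟨g * of (h * h₁), Or.inr ⟨_, by simp, ?_, hx'⟩⟩
  rw [IsReduced, List.isChain_append]
  refine ⟨hred, hred, ?_⟩
  intro y hy z hz hmem
  obtain rfl : y = (u, k') := by simpa [eq_comm] using hy
  by_contra hne
  cases mid with
  | nil =>
    obtain rfl : z = (u, k') := by simpa [eq_comm] using hz
    exact hne rfl
  | cons m mid =>
    obtain rfl : z = m := by simpa [eq_comm] using hz
    obtain ⟨v, m⟩ := z
    obtain rfl : v = -u := by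
      rcases Int.units_eq_one_or u with rfl | rfl <;>
      rcases Int.units_eq_one_or v with rfl | rfl <;> simp_all
    have key := t_zpow_mul_of_mul_t_zpow_neg (φ := φ) u ⟨k', hmem⟩
    simp only [List.length_cons] at hlen₁
    have := hmin mid.length ⟨g * of (h * h₁) * (t ^ (u : ℤ) * of k')⁻¹,
      (toSubgroupEquiv φ u ⟨k', hmem⟩ : G) * m, mid, le_rfl, by
        rw [hx', map_mul _ (toSubgroupEquiv φ u ⟨k', hmem⟩ : G) m, ← key]
        simp only [List.cons_append, listProd_cons, listProd_append, listProd_nil]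
        group⟩
    omega

/-- In an HNN extension, an element with two conjugate distinct powers is conjugate into the base
group, since the `p`-th power of a cyclically reduced word has `p` times as many stable letters. -/
theorem exists_conj_eq_of_of_conj_pow_eq {x h : HNNExtension G A B φ} {p q : ℕ} (hpq : p < q)
    (hx : h * x ^ p * h⁻¹ = x ^ q) : ∃ (g : HNNExtension G A B φ) (a : G), x = g * of a * g⁻¹ := by
  obtain ⟨g, ⟨a, ha⟩ | ⟨l, hne, hl, hxl⟩⟩ := exists_conj_eq_of_or_cyclically_reduced x
  · exact ⟨g, a, ha⟩
  exfalso
  have hpow : ∀ k : ℕ, IsReduced A B (List.replicate k l).flatten ∧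
      listProd φ (List.replicate k l).flatten = listProd φ l ^ k := by
    intro k
    induction k with
    | zero => exact ⟨List.isChain_nil, by simp⟩
    | succ k ih =>
      rw [List.replicate_succ, List.flatten_cons, listProd_append, ih.2, pow_succ']
      refine ⟨?_, rfl⟩
      rw [IsReduced, List.isChain_append] at hl ⊢
      refine ⟨hl.1, ih.1, ?_⟩
      cases k with
      | zero => simp
      | succ k =>
        rw [List.replicate_succ, List.flatten_cons, List.head?_append_of_ne_nil _ hne]
        exact hl.2.2
  set y := listProd φ l with hy
  set f := g⁻¹ * h * g with hf
  have hfy : f * y ^ p * f⁻¹ = y ^ q := by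
    rw [hxl, conj_pow, conj_pow] at hx
    have h1 := congrArg (fun z => g⁻¹ * z * g) hx
    simpa [hf, mul_assoc] using h1
  clear_value f
  obtain ⟨h₁, l₁, -, hl₁⟩ := exists_isReduced f
  obtain ⟨h₂, l₂, hl₂, hl₂'⟩ := exists_isReduced f⁻¹
  set K := l₁.length + l₂.length + 1 with hK
  have hfyK : f * y ^ (p * K) * f⁻¹ = y ^ (q * K) := by
    rw [pow_mul, pow_mul, ← hfy, conj_pow]
  obtain ⟨h₃, l₃, hl₃, hlen₃, heq₃⟩ := exists_isReduced_mul (φ := φ)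
    (List.replicate (p * K) l).flatten h₂ hl₂
  obtain ⟨h₄, l₄, hl₄, hlen₄, heq₄⟩ := exists_isReduced_mul (φ := φ) l₁ h₃ hl₃
  have hfin : (of (h₁ * h₄) * listProd φ l₄ : HNNExtension G A B φ) =
      of 1 * listProd φ (List.replicate (q * K) l).flatten := by
    rw [(hpow _).2, map_one, one_mul, ← hfyK, map_mul, mul_assoc, ← heq₄, ← heq₃, (hpow _).2,
      ← mul_assoc, ← hl₁, ← hl₂', mul_assoc]
  have hlen := hl₄.length_eq (hpow _).1 hfin
  have hr : 0 < l.length := List.length_pos_iff.2 hne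
  simp only [List.length_flatten, List.map_replicate, List.sum_replicate, smul_eq_mul] at hlen hlen₃
  have h5 : (p + 1) * K * l.length ≤ q * K * l.length :=
    Nat.mul_le_mul_right _ (Nat.mul_le_mul_right _ hpq)
  have h6 : K ≤ K * l.length := Nat.le_mul_of_pos_right _ hr
  have h7 : (p + 1) * K * l.length = p * K * l.length + K * l.length := by ring
  omega

end HNNExtension

/-! ### The Baumslag–Solitar group `BS(2, 3)` -/

namespace BaumslagSolitar

/-- The subgroup of `k`-th powers of the infinite cyclic group. -/
abbrev powers (k : ℤ) : Subgroup (Multiplicative ℤ) := (zpowGroupHom k).range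

theorem zpow_injective {k : ℤ} (hk : k ≠ 0) :
    Function.Injective (zpowGroupHom k : Multiplicative ℤ →* Multiplicative ℤ) := by
  intro x y h
  have h' : k * x.toAdd = k * y.toAdd := by simpa using congrArg Multiplicative.toAdd h
  exact Multiplicative.toAdd.injective (mul_left_cancel₀ hk h')

/-- The isomorphism `2 k ↦ 3 k` between the two associated subgroups. -/
noncomputable def powersEquiv : powers 2 ≃* powers 3 :=
  (MonoidHom.ofInjective (zpow_injective two_ne_zero)).symm.trans
    (MonoidHom.ofInjective (zpow_injective three_ne_zero))

theorem powersEquiv_apply (x : Multiplicative ℤ) :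
    powersEquiv ⟨x ^ (2 : ℤ), x, rfl⟩ = ⟨x ^ (3 : ℤ), x, rfl⟩ := by
  have : (⟨x ^ (2 : ℤ), x, rfl⟩ : powers 2) = MonoidHom.ofInjective (zpow_injective two_ne_zero) x :=
    rfl
  rw [this, powersEquiv, MulEquiv.trans_apply, MulEquiv.symm_apply_apply]
  rfl

/-- The Baumslag–Solitar group `⟨a, t | t a² t⁻¹ = a³⟩`, as an HNN extension of `⟨a⟩`. -/
abbrev Group23 : Type := HNNExtension (Multiplicative ℤ) (powers 2) (powers 3) powersEquiv

/-- The generator `a` of `BS(2, 3)`. -/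
noncomputable def a : Group23 := HNNExtension.of (Multiplicative.ofAdd 1)

/-- The generator `t` of `BS(2, 3)`. -/
noncomputable def t : Group23 := HNNExtension.t

theorem of_eq_zpow (x : Multiplicative ℤ) : (HNNExtension.of x : Group23) = a ^ x.toAdd := by
  rw [a, ← map_zpow]
  congr 1
  apply Multiplicative.toAdd.injective
  simp

theorem t_mul_a_sq_mul_t_inv : t * a ^ 2 * t⁻¹ = a ^ 3 := by
  have h := (HNNExtension.equiv_eq_conj (φ := powersEquiv)
    ⟨Multiplicative.ofAdd 1 ^ (2 : ℤ), Multiplicative.ofAdd 1, rfl⟩).symm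
  rw [powersEquiv_apply] at h
  simp only [map_zpow] at h
  exact_mod_cast h

/-- The homomorphism from `BS(2, 3)` given by images of `a` and `t` satisfying the relation. -/
noncomputable def lift {H : Type*} [Group H] (x y : H) (h : y * x ^ 2 * y⁻¹ = x ^ 3) :
    Group23 →* H :=
  HNNExtension.lift (zpowersHom H x) y (by
    rintro ⟨_, z, rfl⟩
    have : powersEquiv ⟨zpowGroupHom 2 z, z, rfl⟩ = ⟨z ^ (3 : ℤ), z, rfl⟩ := powersEquiv_apply z
    rw [this]
    have h2 : SemiconjBy y (x ^ 2) (x ^ 3) := by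
      rw [SemiconjBy, ← h]; group
    have h3 := (h2.zpow_right z.toAdd).eq
    rw [← zpow_natCast, ← zpow_natCast, ← zpow_mul, ← zpow_mul] at h3
    simpa [mul_comm] using h3)

@[simp]
theorem lift_a {H : Type*} [Group H] (x y : H) (h : y * x ^ 2 * y⁻¹ = x ^ 3) :
    lift x y h a = x := by
  simp [lift, a]

@[simp]
theorem lift_t {H : Type*} [Group H] (x y : H) (h : y * x ^ 2 * y⁻¹ = x ^ 3) :
    lift x y h t = y := by
  simp [lift, t]

theorem hom_ext {H : Type*} [Group H] {f g : Group23 →* H} (ha : f a = g a) (ht : f t = g t) :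
    f = g :=
  HNNExtension.hom_ext (MonoidHom.ext_mint ha) ht

theorem ofAdd_not_mem_toSubgroup {k : ℤ} (hk : k = 1 ∨ k = -1) (u : ℤˣ) :
    Multiplicative.ofAdd k ∉ HNNExtension.toSubgroup (powers 2) (powers 3) u := by
  have key : ∀ n : ℤ, n = 2 ∨ n = 3 → Multiplicative.ofAdd k ∉ powers n := by
    rintro n hn ⟨x, hx⟩
    have h' : n * x.toAdd = k := by simpa using congrArg Multiplicative.toAdd hx
    rcases hn with rfl | rfl <;> omega
  rcases Int.units_eq_one_or u with rfl | rfl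
  · exact key 2 (Or.inl rfl)
  · exact key 3 (Or.inr rfl)

/-- The `a`-letter preceding the first stable letter in the image of a word in
`t * a * t⁻¹ * a⁻¹ * t` and `a⁻¹ * t * a`. -/
def wordHead : List (Fin 2 × Bool) → Multiplicative ℤ
  | (1, _) :: _ => Multiplicative.ofAdd (-1)
  | _ => 1

/-- The pairs spelling the image of a word in `t * a * t⁻¹ * a⁻¹ * t` and `a⁻¹ * t * a`, after the
leading letter `wordHead`. -/
def wordTail : List (Fin 2 × Bool) → List (ℤˣ × Multiplicative ℤ)
  | [] => []
  | (0, b) :: l => (if b then 1 else -1, Multiplicative.ofAdd 1) ::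
      (if b then -1 else 1, Multiplicative.ofAdd (-1)) :: (if b then 1 else -1, wordHead l) ::
        wordTail l
  | (1, b) :: l => (if b then 1 else -1, Multiplicative.ofAdd 1 * wordHead l) :: wordTail l

theorem wordTail_head? (l : List (Fin 2 × Bool)) :
    ∀ x ∈ (wordTail l).head?, ∃ y ∈ l.head?, x.1 = if y.2 then 1 else -1 := by
  rcases l with _ | ⟨⟨i, b⟩, l⟩
  · simp [wordTail]
  · fin_cases i <;> simp [wordTail]

theorem isReduced_wordTail {l : List (Fin 2 × Bool)} (hl : FreeGroup.IsReduced l) :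
    HNNExtension.IsReduced (powers 2) (powers 3) (wordTail l) := by
  induction l with
  | nil => exact List.isChain_nil
  | cons x l ih =>
    have hl' := List.isChain_cons.1 hl
    have ih := ih hl'.2
    obtain ⟨i, b⟩ := x
    -- the letter between two image blocks of opposite signs is `a` or `a⁻¹`
    have hjoin : ∀ y ∈ (wordTail l).head?,
        (if i = 0 then wordHead l else Multiplicative.ofAdd 1 * wordHead l) ∈
          HNNExtension.toSubgroup (powers 2) (powers 3) (if b then 1 else -1) →
        (if b then 1 else -1) = y.1 := by
      intro y hy hmem
      obtain ⟨⟨j, c⟩, hz, hyz⟩ := wordTail_head? l y hy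
      have hij : i = j → b = c := fun h => hl'.1 _ hz h
      rcases l with _ | ⟨z, l⟩
      · simp at hz
      obtain rfl : z = (j, c) := by simpa using hz
      rw [hyz]
      by_cases hbc : b = c
      · simp [hbc]
      exfalso
      have hij' : i ≠ j := fun h => hbc (hij h)
      fin_cases i <;> fin_cases j
      · exact hij' rfl
      · exact ofAdd_not_mem_toSubgroup (Or.inr rfl) _ (by simpa [wordHead] using hmem)
      · exact ofAdd_not_mem_toSubgroup (Or.inl rfl) _ (by simpa [wordHead] using hmem)
      · exact hij' rfl
    have h1 := ofAdd_not_mem_toSubgroup (k := 1) (Or.inl rfl)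
    have h2 := ofAdd_not_mem_toSubgroup (k := -1) (Or.inr rfl)
    fin_cases i
    · simp only [wordTail, HNNExtension.IsReduced, List.isChain_cons_cons]
      refine ⟨fun h => absurd h (h1 _), fun h => absurd h (h2 _), ?_⟩
      exact List.isChain_cons.2 ⟨by simpa using hjoin, ih⟩
    · simp only [wordTail, HNNExtension.IsReduced]
      exact List.isChain_cons.2 ⟨by simpa using hjoin, ih⟩

/-- The elements `t * a * t⁻¹ * a⁻¹ * t` and `a⁻¹ * t * a` generate a free group, since no
cancellation happens in reduced products of them. -/
theorem lift_conj_injective :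
    Function.Injective (FreeGroup.lift ![t * a * t⁻¹ * a⁻¹ * t, a⁻¹ * t * a]) := by
  have hprod : ∀ l : List (Fin 2 × Bool),
      FreeGroup.lift ![t * a * t⁻¹ * a⁻¹ * t, a⁻¹ * t * a] (FreeGroup.mk l) =
        HNNExtension.of (wordHead l) * HNNExtension.listProd powersEquiv (wordTail l) := by
    intro l
    induction l with
    | nil => simp [wordHead, wordTail]
    | cons x l ih =>
      have hx : FreeGroup.mk (x :: l) = FreeGroup.mk [x] * FreeGroup.mk l := by
        simp [FreeGroup.mul_mk]
      rw [hx, map_mul, ih]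
      obtain ⟨i, b⟩ := x
      have ht : (HNNExtension.t : Group23) = t := rfl
      fin_cases i <;> cases b <;>
        simp [wordHead, wordTail, FreeGroup.lift_mk, of_eq_zpow, ht, mul_assoc, zpow_one_add]
  rw [injective_iff_map_eq_one]
  intro w hw
  rw [← FreeGroup.mk_toWord (x := w), hprod] at hw
  have hred := isReduced_wordTail (FreeGroup.isReduced_toWord (x := w))
  have hlen := hred.length_eq (A := powers 2) (B := powers 3) (φ := powersEquiv) (h' := 1)
    (List.isChain_nil : HNNExtension.IsReduced (powers 2) (powers 3) []) (by simpa using hw)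
  have hnil : w.toWord = [] := by
    rcases hw' : w.toWord with _ | ⟨⟨i, b⟩, l⟩
    · rfl
    · rw [hw'] at hlen
      fin_cases i <;> simp [wordTail] at hlen
  rw [← FreeGroup.mk_toWord (x := w), hnil]
  rfl

/-- `⁅a, t * a * t⁻¹⁆` and `t` freely generate a free group: after conjugation by `a` and a change of
basis they become the pair of `lift_conj_injective`. -/
theorem injective_lift_commutator_t :
    Function.Injective (FreeGroup.lift ![⁅a, t * a * t⁻¹⁆, t]) := by
  let c : Group23 := ⁅a, t * a * t⁻¹⁆
  let σ : FreeGroup (Fin 2) →* FreeGroup (Fin 2) :=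
    FreeGroup.lift ![FreeGroup.of 0 * (FreeGroup.of 1)⁻¹, FreeGroup.of 1]
  let σ' : FreeGroup (Fin 2) →* FreeGroup (Fin 2) :=
    FreeGroup.lift ![FreeGroup.of 0 * FreeGroup.of 1, FreeGroup.of 1]
  have hσ : Function.LeftInverse σ' σ := by
    have : σ'.comp σ = MonoidHom.id _ := by
      ext i; fin_cases i <;> simp [σ, σ']
    exact DFunLike.congr_fun this
  have hfac : (FreeGroup.lift ![c, t]) = (MulAut.conj a).toMonoidHom.comp
      ((FreeGroup.lift ![t * a * t⁻¹ * a⁻¹ * t, a⁻¹ * t * a]).comp σ) := by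
    ext i; fin_cases i <;> simp [σ, c, commutatorElement_def, mul_assoc]
  change Function.Injective (FreeGroup.lift ![c, t])
  rw [hfac]
  exact (MulAut.conj a).injective.comp (lift_conj_injective.comp hσ.injective)

theorem injective_lift_t_commutator :
    Function.Injective (FreeGroup.lift ![t, ⁅a, t * a * t⁻¹⁆]) := by
  have hfac : FreeGroup.lift ![t, ⁅a, t * a * t⁻¹⁆] =
      (FreeGroup.lift ![⁅a, t * a * t⁻¹⁆, t]).comp
        (FreeGroup.freeGroupCongr (Equiv.swap 0 1)).toMonoidHom := by
    ext i; fin_cases i <;> simp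
  rw [hfac]
  exact injective_lift_commutator_t.comp (FreeGroup.freeGroupCongr _).injective

theorem commutator_ne_one : ⁅a, t * a * t⁻¹⁆ ≠ 1 := by
  intro h
  have := @injective_lift_commutator_t (FreeGroup.of 0) 1 (by simpa using h)
  exact FreeGroup.of_ne_one 0 this

theorem a_zpow_ne_one {k : ℤ} (hk : k ≠ 0) : a ^ k ≠ 1 := by
  intro h
  have h1 : (HNNExtension.of (Multiplicative.ofAdd k) : Group23) = 1 := by
    rw [of_eq_zpow]; exact h
  rw [← map_one (HNNExtension.of : _ →* Group23)] at h1
  exact hk (Multiplicative.ofAdd.injective (HNNExtension.of_injective _ h1))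

end BaumslagSolitar

/-! ### Kernels of the maps from the free group to `BS(2, 3)` -/

theorem MonoidHom.exists_mulEquiv_of_ker_eq {G G' H H' : Type*} [Group G] [Group G'] [Group H]
    [Group H'] {p : G →* H} {p' : G' →* H'} (hp : Function.Surjective p)
    (hp' : Function.Surjective p') (F : G ≃* G') (h : ∀ g, p g = 1 ↔ p' (F g) = 1) :
    ∃ φ : H ≃* H', ∀ g, φ (p g) = p' (F g) := by
  have hF : Function.Surjective (p'.comp F.toMonoidHom) := hp'.comp F.surjective
  have hker : p.ker = (p'.comp F.toMonoidHom).ker := by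
    ext g; exact h g
  refine ⟨(QuotientGroup.quotientKerEquivOfSurjective p hp).symm.trans
    ((QuotientGroup.quotientMulEquivOfEq hker).trans
      (QuotientGroup.quotientKerEquivOfSurjective _ hF)), fun g => ?_⟩
  have h1 : (QuotientGroup.quotientKerEquivOfSurjective p hp).symm (p g) = (g : G ⧸ p.ker) := by
    rw [MulEquiv.symm_apply_eq]; rfl
  simp only [MulEquiv.trans_apply, h1]
  rfl

/-- If `y` conjugates `z ^ 2` to `z ^ 3`, then `z = (y * z ^ 2 * y⁻¹) * (z ^ 2)⁻¹`, and this applies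
to all powers `z` of `x`. -/
theorem Subgroup.mem_of_pow_two_pow_mem {G : Type*} [Group G] (S : Subgroup G) {x y : G}
    (h : y * x ^ 2 * y⁻¹ = x ^ 3) (hy : y ∈ S) {n : ℕ} (hx : x ^ 2 ^ n ∈ S) : x ∈ S := by
  induction n with
  | zero => simpa using hx
  | succ n ih =>
    refine ih ?_
    have h2 : y * (x ^ 2 ^ n) ^ 2 * y⁻¹ = (x ^ 2 ^ n) ^ 3 := by
      have := congrArg (· ^ 2 ^ n) h
      simp only [conj_pow] at this
      rwa [← pow_mul, ← pow_mul, mul_comm 2, mul_comm 3, pow_mul, pow_mul] at this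
    rw [pow_succ, pow_mul] at hx
    have h3 : (x ^ 2 ^ n) ^ 3 ∈ S := h2 ▸ S.mul_mem (S.mul_mem hy hx) (S.inv_mem hy)
    have h4 : x ^ 2 ^ n = (x ^ 2 ^ n) ^ 3 * ((x ^ 2 ^ n) ^ 2)⁻¹ := by group
    rw [h4]
    exact S.mul_mem h3 (S.inv_mem hx)

/-- The group of affine maps `x ↦ u * x + b` of a commutative ring. -/
@[ext]
structure AffineGroup (R : Type*) [CommRing R] where
  /-- The translation part. -/
  b : R
  /-- The linear part. -/
  u : Rˣ

namespace AffineGroup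

variable {R : Type*} [CommRing R]

instance : Mul (AffineGroup R) := ⟨fun f g => ⟨f.b + f.u * g.b, f.u * g.u⟩⟩
instance : One (AffineGroup R) := ⟨⟨0, 1⟩⟩
instance : Inv (AffineGroup R) := ⟨fun f => ⟨-(↑f.u⁻¹ * f.b), f.u⁻¹⟩⟩

@[simp] theorem mul_b (f g : AffineGroup R) : (f * g).b = f.b + f.u * g.b := rfl
@[simp] theorem mul_u (f g : AffineGroup R) : (f * g).u = f.u * g.u := rfl
@[simp] theorem one_b : (1 : AffineGroup R).b = 0 := rfl
@[simp] theorem one_u : (1 : AffineGroup R).u = 1 := rfl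
@[simp] theorem inv_b (f : AffineGroup R) : f⁻¹.b = -(↑f.u⁻¹ * f.b) := rfl
@[simp] theorem inv_u (f : AffineGroup R) : f⁻¹.u = f.u⁻¹ := rfl

instance : Group (AffineGroup R) :=
  Group.ofLeftAxioms
    (fun f g h => by ext <;> simp [mul_add, add_assoc, mul_assoc])
    (fun f => by ext <;> simp)
    (fun f => by ext <;> simp)

/-- The linear part, as a homomorphism. -/
def linearHom (R : Type*) [CommRing R] : AffineGroup R →* Rˣ where
  toFun := u
  map_one' := rfl
  map_mul' _ _ := rfl

/-- The action of a ring homomorphism, followed by rescaling of the coordinate by `c`. -/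
def mapScale {S : Type*} [CommRing S] (f : R →+* S) (c : S) : AffineGroup R →* AffineGroup S where
  toFun g := ⟨c * f g.b, Units.map f g.u⟩
  map_one' := by ext <;> simp
  map_mul' g h := by
    ext
    · simp; ring
    · simp

/-- The translation by `x`. -/
def translation (x : R) : AffineGroup R := ⟨x, 1⟩

theorem translation_zpow (x : R) (k : ℤ) : translation x ^ k = translation (k * x) := by
  let f : Multiplicative R →* AffineGroup R :=
    { toFun := fun x => translation x.toAdd
      map_one' := rfl
      map_mul' := fun x y => by ext <;> simp [translation] }
  exact (map_zpow f (Multiplicative.ofAdd x) k).symm.trans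
    (congrArg translation (by simp))

theorem translation_pow (x : R) (k : ℕ) : translation x ^ k = translation (k * x) := by
  simpa using translation_zpow x k

theorem conj_translation (g : AffineGroup R) (x : R) :
    g * translation x * g⁻¹ = translation (g.u * x) := by
  ext
  · simp [translation]
  · simp [translation]

/-- A form of the chain rule for Fox derivatives: two homomorphisms to the affine group with the
same linear part, trivial on the first generator, differ by a linear change. -/
theorem lift_translation_apply (y : Rˣ) (ν : FreeGroup (Fin 2) →* AffineGroup R)
    (h0 : (ν (FreeGroup.of 0)).u = 1) (h1 : (ν (FreeGroup.of 1)).u = y) (w : FreeGroup (Fin 2)) :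
    (ν w).u = (FreeGroup.lift ![translation 1, ⟨0, y⟩] w).u ∧
      (y - 1) * (ν w).b =
        (y - 1) * (ν (FreeGroup.of 0)).b * (FreeGroup.lift ![translation 1, ⟨0, y⟩] w).b +
          (ν (FreeGroup.of 1)).b * ((FreeGroup.lift ![translation 1, ⟨0, y⟩] w).u - 1) := by
  set f : FreeGroup (Fin 2) →* AffineGroup R := FreeGroup.lift ![translation 1, ⟨0, y⟩] with hf
  have hof : ∀ i : Fin 2, (ν (FreeGroup.of i)).u = (f (FreeGroup.of i)).u ∧
      (y - 1) * (ν (FreeGroup.of i)).b =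
        (y - 1) * (ν (FreeGroup.of 0)).b * (f (FreeGroup.of i)).b +
          (ν (FreeGroup.of 1)).b * ((f (FreeGroup.of i)).u - 1) := by
    intro i
    fin_cases i
    · simp [hf, h0, translation]
    · simp [hf, h1, mul_comm]
  induction w using FreeGroup.induction_on with
  | C1 => simp
  | of i => exact hof i
  | inv_of i ih =>
    obtain ⟨h2, h3⟩ := ih
    refine ⟨by simp [h2], ?_⟩
    simp only [map_inv, inv_b, inv_u, h2]
    have h4 : ((f (FreeGroup.of i)).u : R) * ((f (FreeGroup.of i)).u⁻¹ : Rˣ) = 1 := by simp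
    linear_combination (-(((f (FreeGroup.of i)).u⁻¹ : Rˣ) : R)) * h3 -
      (ν (FreeGroup.of 1)).b * h4
  | mul v w hv hw =>
    obtain ⟨h2, h3⟩ := hv
    obtain ⟨h4, h5⟩ := hw
    refine ⟨by simp [h2, h4], ?_⟩
    simp only [map_mul, mul_b, mul_u, h2, Units.val_mul]
    linear_combination h3 + ((f v).u : R) * h5

end AffineGroup

/-- The units of `ℤ[T, T⁻¹]` are the elements `± T ^ j`. -/
theorem LaurentPolynomial.exists_eq_T_of_isUnit {p : LaurentPolynomial ℤ} (hp : IsUnit p) :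
    ∃ (e : ℤ) (j : ℤ), IsUnit e ∧ p = LaurentPolynomial.C e * LaurentPolynomial.T j := by
  obtain ⟨q, hq⟩ := hp.exists_right_inv
  obtain ⟨k, P, hP⟩ := p.exists_T_pow
  obtain ⟨l, Q, hQ⟩ := q.exists_T_pow
  have hPQ : P * Q = Polynomial.X ^ (k + l) := by
    refine Polynomial.toLaurent_injective ?_
    rw [map_mul, hP, hQ, Polynomial.toLaurent_X_pow, Nat.cast_add, LaurentPolynomial.T_add]
    linear_combination (LaurentPolynomial.T (k : ℤ) * LaurentPolynomial.T (l : ℤ)) * hq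
  obtain ⟨i, -, hi⟩ := (dvd_prime_pow Polynomial.prime_X _).1 (Dvd.intro _ hPQ)
  obtain ⟨v, hv⟩ := hi.symm
  obtain ⟨e, he, hev⟩ := Polynomial.isUnit_iff.1 v.isUnit
  refine ⟨e, i - k, he, ?_⟩
  have h1 : p = Polynomial.toLaurent P * LaurentPolynomial.T (-k) := by
    rw [hP, mul_assoc, ← LaurentPolynomial.T_add]; simp
  rw [h1, ← hv, ← hev, map_mul, Polynomial.toLaurent_X_pow, Polynomial.toLaurent_C,
    sub_eq_add_neg, LaurentPolynomial.T_add]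
  ring

theorem eq_of_zpow_mul_two_pow {i : ℤ} {n m : ℕ} (h : (3 / 2 : ℚ) ^ i * 2 ^ n = 2 ^ m) :
    n = m := by
  have h3 : ∀ {p k l : ℕ}, 3 ^ p * 2 ^ k = 2 ^ l → p = 0 := by
    intro p k l hp
    by_contra hne
    have : 3 ∣ 2 ^ l := hp ▸ (dvd_pow_self 3 hne).mul_right _
    exact absurd (Nat.prime_three.dvd_of_dvd_pow this) (by norm_num)
  obtain ⟨p, rfl | rfl⟩ := Int.eq_nat_or_neg i
  · have h1 : (3 ^ p * 2 ^ n : ℚ) = 2 ^ (m + p) := by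
      rw [zpow_natCast, div_pow] at h
      field_simp at h
      rw [pow_add, h]
      ring
    obtain rfl := h3 (by exact_mod_cast h1 : 3 ^ p * 2 ^ n = 2 ^ (m + p))
    simpa using h
  · have h1 : (3 ^ p * 2 ^ m : ℚ) = 2 ^ (n + p) := by
      rw [zpow_neg, zpow_natCast, div_pow] at h
      rw [← h, pow_add]
      field_simp
    obtain rfl := h3 (by exact_mod_cast h1 : 3 ^ p * 2 ^ m = 2 ^ (n + p))
    simpa using h

theorem eq_one_of_zpow_mul_intCast {i N : ℤ} (h : (3 / 2 : ℚ) ^ i * N = 1) : N = 1 := by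
  obtain ⟨p, rfl | rfl⟩ := Int.eq_nat_or_neg i
  · have h1 : 3 ^ p * N = 2 ^ p := by
      rw [zpow_natCast, div_pow] at h
      field_simp at h
      exact_mod_cast h
    rcases Nat.eq_zero_or_pos p with rfl | hp
    · simpa using h1
    · have : (3 : ℤ) ∣ 2 ^ p := h1 ▸ (dvd_pow_self 3 hp.ne').mul_right _
      exact absurd (Int.prime_three.dvd_of_dvd_pow this) (by norm_num)
  · have h1 : 2 ^ p * N = 3 ^ p := by
      rw [zpow_neg, zpow_natCast, div_pow] at h
      field_simp at h
      exact_mod_cast h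
    rcases Nat.eq_zero_or_pos p with rfl | hp
    · simpa using h1
    · have : (2 : ℤ) ∣ 3 ^ p := h1 ▸ (dvd_pow_self 2 hp.ne').mul_right _
      exact absurd (Int.prime_two.dvd_of_dvd_pow this) (by norm_num)

namespace BaumslagSolitar

open AffineGroup

/-- The homomorphism `α ↦ a ^ 2 ^ n`, `τ ↦ t` from the free group on two generators. -/
noncomputable def freeMap (n : ℕ) : FreeGroup (Fin 2) →* Group23 :=
  FreeGroup.lift ![a ^ 2 ^ n, t]

theorem closure_a_t : Subgroup.closure {a, t} = ⊤ := by
  let f : Group23 →* Subgroup.closure {a, t} :=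
    lift ⟨a, Subgroup.subset_closure (by simp)⟩ ⟨t, Subgroup.subset_closure (by simp)⟩
      (Subtype.ext t_mul_a_sq_mul_t_inv)
  have hf : (Subgroup.subtype _).comp f = MonoidHom.id _ := hom_ext (by simp [f]) (by simp [f])
  rw [eq_top_iff]
  intro x _
  rw [← MonoidHom.id_apply Group23 x, ← hf]
  exact (f x).2

theorem freeMap_surjective (n : ℕ) : Function.Surjective (freeMap n) := by
  rw [← MonoidHom.range_eq_top, eq_top_iff, ← closure_a_t, Subgroup.closure_le]
  have ht : t ∈ (freeMap n).range := ⟨FreeGroup.of 1, by simp [freeMap]⟩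
  have ha : a ^ 2 ^ n ∈ (freeMap n).range := ⟨FreeGroup.of 0, by simp [freeMap]⟩
  rintro x (rfl | rfl)
  · exact Subgroup.mem_of_pow_two_pow_mem _ t_mul_a_sq_mul_t_inv ht ha
  · exact ht

/-- The unit `3 / 2` of `ℚ`. -/
def threeHalves : ℚˣ := Units.mk0 (3 / 2) (by norm_num)

/-- The affine representation of `BS(2, 3)`, in which `a` is translation by `1` and `t` is
multiplication by `3 / 2`. -/
noncomputable def affineHom : Group23 →* AffineGroup ℚ :=
  lift (translation 1) ⟨0, threeHalves⟩ (by
    rw [translation_pow, translation_pow, conj_translation, threeHalves]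
    norm_num)

/-- The exponent sum of `t`. -/
noncomputable def exponentHom : Group23 →* Multiplicative ℤ :=
  lift 1 (Multiplicative.ofAdd 1) (by simp)

theorem affineHom_u (x : Group23) :
    (((affineHom x).u : ℚˣ) : ℚ) = (3 / 2) ^ (exponentHom x).toAdd := by
  have : (linearHom ℚ).comp affineHom = (zpowersHom ℚˣ threeHalves).comp exponentHom :=
    hom_ext (by simp [affineHom, exponentHom, linearHom, translation])
      (by simp [affineHom, exponentHom, linearHom])
  have h := congrArg Units.val (DFunLike.congr_fun this x)
  simpa [linearHom, threeHalves] using h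

theorem affineHom_conj (g : Group23) (k : ℤ) : affineHom (g * a ^ k * g⁻¹) =
    translation ((3 / 2 : ℚ) ^ (exponentHom g).toAdd * k) := by
  have ha : affineHom a = translation 1 := lift_a _ _ _
  rw [map_mul, map_mul, map_inv, map_zpow, ha, translation_zpow, conj_translation, affineHom_u,
    mul_one]

/-- An endomorphism of `BS(2, 3)` maps `a` to a conjugate of a power of `a`, as its second and third
powers stay conjugate. -/
theorem exists_map_a_eq (f : Group23 →* Group23) : ∃ (g : Group23) (k : ℤ),
    f a = g * a ^ k * g⁻¹ := by
  have h := congrArg f t_mul_a_sq_mul_t_inv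
  simp only [map_mul, map_pow, map_inv] at h
  obtain ⟨g, x, hx⟩ := HNNExtension.exists_conj_eq_of_of_conj_pow_eq (by norm_num) h
  exact ⟨g, x.toAdd, by rw [hx, of_eq_zpow]⟩

/-- The exponents of `a` for an automorphism and for its inverse have product `1`, because `a` is
conjugate to `a ^ N` only for `N = 1`. -/
theorem exists_automorphism_a_eq (χ : Group23 ≃* Group23) : ∃ (g : Group23) (k : ℤ), IsUnit k ∧
    χ a = g * a ^ k * g⁻¹ := by
  obtain ⟨g, k, hk⟩ := exists_map_a_eq χ.toMonoidHom
  obtain ⟨h, l, hl⟩ := exists_map_a_eq χ.symm.toMonoidHom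
  simp only [MulEquiv.toMonoidHom_eq_coe, MonoidHom.coe_coe] at hk hl
  refine ⟨g, k, ?_, hk⟩
  have h1 : a = (χ h * g) * a ^ (k * l) * (χ h * g)⁻¹ := by
    have h2 := congrArg χ hl
    rw [MulEquiv.apply_symm_apply] at h2
    conv_lhs => rw [h2]
    rw [map_mul, map_mul, map_inv, map_zpow, hk, conj_zpow, zpow_mul]
    group
  have h2 := congrArg (fun x => (affineHom x).b) h1
  simp only [affineHom_conj] at h2
  have h3 : k * l = 1 := by
    refine eq_one_of_zpow_mul_intCast (i := (exponentHom (χ h * g)).toAdd) ?_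
    rw [eq_comm]
    simpa [affineHom, translation] using h2
  exact IsUnit.of_mul_eq_one _ h3

/-- The kernels of the maps `freeMap n` are pairwise inequivalent under automorphisms of the free
group. The Fox derivative of `θ α` is a unit `± T ^ j` of `ℤ[T, T⁻¹]`, so in the affine
representation the images of `a ^ 2 ^ n` and `a ^ 2 ^ m` under the induced maps
are translations by numbers that differ by a factor `± (3 / 2) ^ i`. -/
theorem eq_of_ker_freeMap_equiv (θ : FreeGroup (Fin 2) ≃* FreeGroup (Fin 2)) {n m : ℕ}
    (h : ∀ w, freeMap n w = 1 ↔ freeMap m (θ w) = 1) : n = m := by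
  obtain ⟨χ, hχ⟩ := MonoidHom.exists_mulEquiv_of_ker_eq (freeMap_surjective n)
    (freeMap_surjective m) θ h
  obtain ⟨g, k, hk, hg⟩ := exists_automorphism_a_eq χ
  have hα : freeMap m (θ (FreeGroup.of 0)) = g * a ^ (k * 2 ^ n) * g⁻¹ := by
    rw [← hχ]
    simp only [freeMap, FreeGroup.lift_apply_of, Matrix.cons_val_zero, map_pow, hg, conj_pow]
    rw [zpow_mul]
    norm_cast
  -- the translation part of `μ` is the Fox derivative with respect to the first generator
  let T : (LaurentPolynomial ℤ)ˣ := (LaurentPolynomial.isUnit_T (1 : ℤ)).unit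
  have hT : (T : LaurentPolynomial ℤ) = LaurentPolynomial.T 1 := rfl
  let μ : FreeGroup (Fin 2) →* AffineGroup (LaurentPolynomial ℤ) :=
    FreeGroup.lift ![translation 1, ⟨0, T⟩]
  have hμu : ∀ w, (μ w).u = T ^ (exponentHom (freeMap m w)).toAdd := by
    intro w
    have : (linearHom _).comp μ = (zpowersHom _ T).comp (exponentHom.comp (freeMap m)) := by
      ext i
      fin_cases i <;> simp [linearHom, μ, exponentHom, freeMap, translation]
    simpa [linearHom] using DFunLike.congr_fun this w
  set ν : FreeGroup (Fin 2) →* AffineGroup (LaurentPolynomial ℤ) := μ.comp θ.toMonoidHom with hν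
  have hν0 : (ν (FreeGroup.of 0)).u = 1 := by
    have : (ν (FreeGroup.of 0)).u = (μ (θ (FreeGroup.of 0))).u := rfl
    rw [this, hμu, hα]
    simp [exponentHom]
  obtain ⟨y, hy⟩ : ∃ y, (ν (FreeGroup.of 1)).u = y := ⟨_, rfl⟩
  have hy1 : y ≠ 1 := by
    rintro rfl
    have htriv : (linearHom _).comp ν = 1 := by
      refine FreeGroup.ext_hom _ _ fun i => ?_
      fin_cases i
      · exact hν0
      · exact hy
    have h1 := congrArg Units.val (DFunLike.congr_fun htriv (θ.symm (FreeGroup.of 1)))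
    have h2 : (LaurentPolynomial.T 1 : LaurentPolynomial ℤ) = LaurentPolynomial.T 0 := by
      simpa [linearHom, hν, μ, hT] using h1
    have h3 := congrArg (LaurentPolynomial.eval₂ (Int.castRingHom ℚ) threeHalves) h2
    rw [LaurentPolynomial.eval₂_T, LaurentPolynomial.eval₂_T] at h3
    norm_num [threeHalves] at h3
  have hchain := lift_translation_apply y ν hν0 hy (θ.symm (FreeGroup.of 0))
  have hνα : ν (θ.symm (FreeGroup.of 0)) = translation 1 := by simp [hν, μ]
  rw [hνα] at hchain
  obtain ⟨hc1, hc2⟩ := hchain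
  rw [← hc1] at hc2
  have hy0 : (y : LaurentPolynomial ℤ) - 1 ≠ 0 := sub_ne_zero.2 fun h => hy1 (Units.ext h)
  have hunit : IsUnit (ν (FreeGroup.of 0)).b := by
    refine IsUnit.of_mul_eq_one
      (FreeGroup.lift ![translation 1, ⟨0, y⟩] (θ.symm (FreeGroup.of 0))).b
      (mul_left_cancel₀ hy0 ?_)
    rw [← mul_assoc]
    simpa [translation] using hc2.symm
  obtain ⟨e, j, he, hej⟩ := LaurentPolynomial.exists_eq_T_of_isUnit hunit
  -- specialize to the affine representation of `BS(2, 3)`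
  have hspec : affineHom.comp (freeMap m) =
      (mapScale (LaurentPolynomial.eval₂ (Int.castRingHom ℚ) threeHalves) (2 ^ m)).comp μ := by
    refine FreeGroup.ext_hom _ _ fun i => ?_
    fin_cases i
    · simp only [affineHom, freeMap, μ, Fin.zero_eta, MonoidHom.comp_apply,
        FreeGroup.lift_apply_of, Matrix.cons_val_zero, map_pow, lift_a, translation_pow]
      ext <;> simp [mapScale, translation]
    · ext <;> simp [affineHom, freeMap, μ, mapScale, hT, LaurentPolynomial.eval₂_T]
  have hb := congrArg AffineGroup.b (DFunLike.congr_fun hspec (θ (FreeGroup.of 0)))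
  have hνb : (μ (θ (FreeGroup.of 0))).b = (ν (FreeGroup.of 0)).b := rfl
  simp only [MonoidHom.comp_apply, hα, affineHom_conj] at hb
  have hb' : (3 / 2 : ℚ) ^ (exponentHom g).toAdd * (k * 2 ^ n) = 2 ^ m * (e * (3 / 2) ^ j) := by
    have h1 := hb
    simp only [mapScale, MonoidHom.coe_mk, OneHom.coe_mk, hνb, hej, map_mul,
      LaurentPolynomial.eval₂_C, LaurentPolynomial.eval₂_T, translation] at h1
    simpa [threeHalves] using h1
  have habs := congrArg abs hb'
  have hke : |(k : ℚ)| = 1 ∧ |(e : ℚ)| = 1 := by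
    constructor
    · exact_mod_cast Int.isUnit_iff_abs_eq.1 hk
    · exact_mod_cast Int.isUnit_iff_abs_eq.1 he
  have hpos : ∀ i : ℤ, |(3 / 2 : ℚ) ^ i| = (3 / 2) ^ i := fun i => abs_of_pos (by positivity)
  rw [abs_mul, abs_mul, abs_mul, abs_mul, hpos, hpos, hke.1, hke.2, one_mul, one_mul, abs_pow,
    abs_pow, abs_two] at habs
  refine eq_of_zpow_mul_two_pow (i := (exponentHom g).toAdd - j) ?_
  rw [zpow_sub₀ (by norm_num), div_mul_eq_mul_div, habs]
  field_simp

end BaumslagSolitar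

/-! ### Centralizers in free groups -/

theorem FreeGroup.commute_of_commute {ι : Type*} {z x y : FreeGroup ι} (hz : z ≠ 1)
    (hx : Commute x z) (hy : Commute y z) : Commute x y := by
  have hcomm : ∀ a b : FreeGroup Unit, Commute a b := by
    intro a b
    obtain ⟨g, hg⟩ := IsCyclic.exists_generator (α := FreeGroup Unit)
    obtain ⟨k, rfl⟩ := hg a
    obtain ⟨l, rfl⟩ := hg b
    exact (Commute.refl g).zpow_zpow k l
  rcases isEmpty_or_nonempty ι with h | h
  · exact absurd (Subsingleton.elim z 1) hz
  set e := freeGroupEquivCoprodI (ι := ι)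
  have hx' := hx.map e
  have hy' := hy.map e
  have key : Commute (e x) (e y) := by
    rcases Monoid.CoprodI.centralizer_commutative_or_conj_of (z := e z) (by simpa using hz) with
      h | ⟨g, i, m, -, -, h⟩
    · exact h _ _ hx' hy'
    · obtain ⟨a, -, ha⟩ := h _ hx'
      obtain ⟨b, -, hb⟩ := h _ hy'
      rw [ha, hb, Commute.conj_iff]
      exact (hcomm a b).map _
  simpa using key.map e.symm

/-! ### The group `B` -/

namespace GroupB

/-- The generator `a i` of `B`. -/
def a (i : Fin 2) : GroupB := PresentedGroup.of (BGen.a i)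

/-- The generator `t i` of `B`. -/
def t (i : Fin 2) : GroupB := PresentedGroup.of (BGen.t i)

theorem t_mul_a_sq_mul_t_inv (i : Fin 2) : t i * a i ^ 2 * (t i)⁻¹ = a i ^ 3 := by
  have h : PresentedGroup.mk BGen.rels (BGen.bsRel i) = 1 := by
    refine (QuotientGroup.eq_one_iff _).2 (Subgroup.subset_normalClosure ?_)
    fin_cases i <;> simp [BGen.rels]
  simp only [BGen.bsRel, map_mul, map_pow, map_inv] at h
  exact mul_inv_eq_one.1 h

theorem t_eq_commutator {i j : Fin 2} (hij : i ≠ j) : t j = ⁅a i, t i * a i * (t i)⁻¹⁆ := by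
  have h : PresentedGroup.mk BGen.rels (BGen.amalgRel i j) = 1 := by
    refine (QuotientGroup.eq_one_iff _).2 (Subgroup.subset_normalClosure ?_)
    fin_cases i <;> fin_cases j <;> simp_all [BGen.rels]
  simp only [BGen.amalgRel, map_mul, map_inv, map_commutatorElement] at h
  exact inv_mul_eq_one.1 h

theorem closure_eq_top : Subgroup.closure (Set.range a ∪ Set.range t) = ⊤ := by
  rw [eq_top_iff, ← PresentedGroup.closure_range_of, Subgroup.closure_le]
  rintro _ ⟨i | i, rfl⟩
  · exact Subgroup.subset_closure (Or.inl ⟨i, rfl⟩)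
  · exact Subgroup.subset_closure (Or.inr ⟨i, rfl⟩)

/-- `B` is perfect: the relators make each `t i` a commutator and `a i` trivial modulo the `t i`. -/
theorem commutator_eq_top : commutator GroupB = ⊤ := by
  have ht : ∀ i, t i ∈ commutator GroupB := by
    intro i
    obtain ⟨j, hj⟩ := exists_ne i
    rw [t_eq_commutator hj]
    exact Subgroup.commutator_mem_commutator (Subgroup.mem_top _) (Subgroup.mem_top _)
  rw [eq_top_iff, ← closure_eq_top, Subgroup.closure_le]
  rintro _ (⟨i, rfl⟩ | ⟨i, rfl⟩)
  -- `a i = a i ^ 3 * (a i ^ 2)⁻¹` is the commutator of `t i` and `a i ^ 2`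
  · have h1 : a i = t i * (a i ^ 2 * (t i)⁻¹ * (a i ^ 2)⁻¹) := by
      rw [← mul_assoc, ← mul_assoc, t_mul_a_sq_mul_t_inv]; group
    rw [h1]
    exact mul_mem (ht i)
      ((inferInstance : (commutator GroupB).Normal).conj_mem _ (inv_mem (ht i)) _)
  · exact ht i

/-- The homomorphism from `BS(2, 3)` onto the subgroup of `B` generated by `a 0` and `t 0`. -/
noncomputable def ofBaumslagSolitar : BaumslagSolitar.Group23 →* GroupB :=
  BaumslagSolitar.lift (a 0) (t 0) (t_mul_a_sq_mul_t_inv 0)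

/-- The embeddings of the free group into two copies of `BS(2, 3)` along which `B` is an amalgam:
the `k`-th generator is sent to `t` in the `k`-th copy and to `⁅a, t * a * t⁻¹⁆` in the other
one. -/
noncomputable def amalgMap (i : Fin 2) : FreeGroup (Fin 2) →* BaumslagSolitar.Group23 :=
  FreeGroup.lift fun k => if k = i then BaumslagSolitar.t else
    ⁅BaumslagSolitar.a, BaumslagSolitar.t * BaumslagSolitar.a * BaumslagSolitar.t⁻¹⁆

theorem amalgMap_injective (i : Fin 2) : Function.Injective (amalgMap i) := by
  fin_cases i
  · convert BaumslagSolitar.injective_lift_t_commutator using 2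
    refine FreeGroup.ext_hom _ _ fun k => ?_
    fin_cases k <;> simp [amalgMap]
  · convert BaumslagSolitar.injective_lift_commutator_t using 2
    refine FreeGroup.ext_hom _ _ fun k => ?_
    fin_cases k <;> simp [amalgMap]

/-- `BS(2, 3)` embeds in `B`, because it embeds in the amalgam of two copies of itself along
`⟨t, ⁅a, t * a * t⁻¹⁆⟩`, a free group of rank two. -/
theorem ofBaumslagSolitar_injective : Function.Injective ofBaumslagSolitar := by
  let ι := fun i => Monoid.PushoutI.of (φ := amalgMap) i
  have hglue : ∀ i j : Fin 2, i ≠ j →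
      ι j BaumslagSolitar.t = ι i ⁅BaumslagSolitar.a,
        BaumslagSolitar.t * BaumslagSolitar.a * BaumslagSolitar.t⁻¹⁆ := by
    intro i j hij
    have h1 := Monoid.PushoutI.of_apply_eq_base amalgMap i (FreeGroup.of j)
    have h2 := Monoid.PushoutI.of_apply_eq_base amalgMap j (FreeGroup.of j)
    rw [← h1] at h2
    simpa [amalgMap, hij.symm] using h2
  let f : BGen → Monoid.PushoutI amalgMap := fun x => match x with
    | .a i => ι i BaumslagSolitar.a
    | .t i => ι i BaumslagSolitar.t
  have hbs : ∀ i, FreeGroup.lift f (BGen.bsRel i) = 1 := by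
    intro i
    have h := congrArg (ι i) BaumslagSolitar.t_mul_a_sq_mul_t_inv
    simp only [map_mul, map_pow, map_inv] at h
    simp only [BGen.bsRel, map_mul, map_pow, map_inv, FreeGroup.lift_apply_of]
    exact mul_inv_eq_one.2 h
  have ham : ∀ i j, i ≠ j → FreeGroup.lift f (BGen.amalgRel i j) = 1 := by
    intro i j hij
    have h := hglue i j hij
    simp only [map_commutatorElement, map_mul, map_inv] at h
    simp only [BGen.amalgRel, map_mul, map_inv, map_commutatorElement, FreeGroup.lift_apply_of]
    exact inv_mul_eq_one.2 h
  have hf : ∀ r ∈ BGen.rels, FreeGroup.lift f r = 1 := by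
    rintro r (rfl | rfl | rfl | rfl)
    · exact hbs 0
    · exact hbs 1
    · exact ham 0 1 (by decide)
    · exact ham 1 0 (by decide)
  have hcomp : (PresentedGroup.toGroup hf).comp ofBaumslagSolitar = ι 0 :=
    BaumslagSolitar.hom_ext (by simp [ofBaumslagSolitar, a, f, ι])
      (by simp [ofBaumslagSolitar, t, f, ι])
  have hinj : Function.Injective ((PresentedGroup.toGroup hf).comp ofBaumslagSolitar) :=
    hcomp ▸ Monoid.PushoutI.of_injective amalgMap_injective 0
  exact Function.Injective.of_comp hinj

theorem not_commute_a_conj : ¬ Commute (a 0) (t 0 * a 0 * (t 0)⁻¹) := by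
  intro h
  refine BaumslagSolitar.commutator_ne_one (ofBaumslagSolitar_injective ?_)
  simpa [ofBaumslagSolitar, map_commutatorElement] using commutatorElement_eq_one_iff_commute.2 h

theorem a_pow_three_ne_one : a 0 ^ 3 ≠ 1 := by
  intro h
  refine BaumslagSolitar.a_zpow_ne_one (k := 3) (by norm_num) (ofBaumslagSolitar_injective ?_)
  simp only [map_zpow, map_one, ofBaumslagSolitar, BaumslagSolitar.lift_a]
  exact_mod_cast h

end GroupB

/-! ### The group `Λ` -/

namespace GroupLambda

open LambdaGen

/-- The generator `ζ` of `Λ`. -/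
def zeta : GroupLambda := PresentedGroup.of ζ

theorem commute_zeta {x : GroupLambda}
    (hx : x = PresentedGroup.of (α 0) ∨ x = PresentedGroup.of (τ 0)) : Commute x zeta := by
  have h : ∀ s, ⁅FreeGroup.of s, FreeGroup.of ζ⁆ ∈ LambdaGen.rels →
      Commute (PresentedGroup.of s : GroupLambda) zeta := by
    intro s hs
    have h1 : PresentedGroup.mk LambdaGen.rels ⁅FreeGroup.of s, FreeGroup.of ζ⁆ = 1 :=
      (QuotientGroup.eq_one_iff _).2 (Subgroup.subset_normalClosure hs)
    rw [map_commutatorElement] at h1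
    exact commutatorElement_eq_one_iff_commute.1 h1
  rcases hx with rfl | rfl
  · exact h _ (Or.inl rfl)
  · exact h _ (Or.inr rfl)

/-- The inclusion of the free group on `α i` and `τ i`. -/
def freeIncl (i : Fin 2) : FreeGroup (Fin 2) →* GroupLambda :=
  FreeGroup.lift ![PresentedGroup.of (α i), PresentedGroup.of (τ i)]

theorem commute_freeIncl_zeta (w : FreeGroup (Fin 2)) : Commute (freeIncl 0 w) zeta := by
  induction w using FreeGroup.induction_on with
  | C1 => simp
  | of i => fin_cases i <;> simp [freeIncl, commute_zeta]
  | inv_of i h => simpa using h.inv_left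
  | mul x y hx hy => simpa using hx.mul_left hy

/-- The factors of `Λ` as a free product. -/
def Factor : Bool → Type
  | true => FreeGroup (Fin 2) × Multiplicative ℤ
  | false => FreeGroup (Fin 2)

instance : ∀ b, Group (Factor b)
  | true => inferInstanceAs (Group (FreeGroup (Fin 2) × Multiplicative ℤ))
  | false => inferInstanceAs (Group (FreeGroup (Fin 2)))

/-- The inclusion of the factor `⟨α 0, τ 0, ζ⟩` of `Λ`. -/
def prodIncl : FreeGroup (Fin 2) × Multiplicative ℤ →* GroupLambda :=
  (freeIncl 0).noncommCoprod (zpowersHom _ zeta)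
    fun w k => by rw [zpowersHom_apply]; exact (commute_freeIncl_zeta w).zpow_right _

theorem prodIncl_apply (w : FreeGroup (Fin 2)) (k : Multiplicative ℤ) :
    prodIncl (w, k) = freeIncl 0 w * zeta ^ k.toAdd := by
  rw [prodIncl, MonoidHom.noncommCoprod_apply, zpowersHom_apply]

/-- The inclusions of the factors of `Λ`. -/
def factorIncl : ∀ b, Factor b →* GroupLambda
  | true => prodIncl
  | false => freeIncl 1

/-- The inclusion of `FreeGroup (Fin 2) × ℤ` in the free product. -/
def ofProd : FreeGroup (Fin 2) × Multiplicative ℤ →* Monoid.CoprodI Factor :=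
  Monoid.CoprodI.of (M := Factor) (i := true)

/-- The inclusion of the second free group in the free product. -/
def ofFree : FreeGroup (Fin 2) →* Monoid.CoprodI Factor :=
  Monoid.CoprodI.of (M := Factor) (i := false)

/-- The images of the generators of `Λ` in the free product. -/
def genMap : LambdaGen → Monoid.CoprodI Factor
  | α i => if i = 0 then ofProd (FreeGroup.of 0, 1) else ofFree (FreeGroup.of 0)
  | τ i => if i = 0 then ofProd (FreeGroup.of 1, 1) else ofFree (FreeGroup.of 1)
  | ζ => ofProd (1, Multiplicative.ofAdd 1)

theorem lift_genMap_eq_one : ∀ r ∈ LambdaGen.rels, FreeGroup.lift genMap r = 1 := by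
  rintro r (rfl | rfl) <;>
  · rw [map_commutatorElement, FreeGroup.lift_apply_of, FreeGroup.lift_apply_of,
      commutatorElement_eq_one_iff_commute]
    refine Commute.map ?_ ofProd
    ext <;> simp

/-- The homomorphism from `Λ` to the free product of its factors. -/
def toCoprodI : GroupLambda →* Monoid.CoprodI Factor := PresentedGroup.toGroup lift_genMap_eq_one

theorem toCoprodI_freeIncl_one (w : FreeGroup (Fin 2)) :
    toCoprodI (freeIncl 1 w) = ofFree w := by
  have : toCoprodI.comp (freeIncl 1) = ofFree := by
    refine FreeGroup.ext_hom _ _ fun k => ?_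
    fin_cases k <;> simp [toCoprodI, freeIncl, genMap]
  exact DFunLike.congr_fun this w

theorem toCoprodI_prodIncl (x : FreeGroup (Fin 2) × Multiplicative ℤ) :
    toCoprodI (prodIncl x) = ofProd x := by
  obtain ⟨w, k⟩ := x
  have h1 : toCoprodI.comp (freeIncl 0) = ofProd.comp (MonoidHom.inl _ _) := by
    refine FreeGroup.ext_hom _ _ fun k => ?_
    fin_cases k <;> simp [toCoprodI, freeIncl, genMap]
  have h2 : toCoprodI zeta = ofProd (1, Multiplicative.ofAdd 1) := by
    simp [toCoprodI, zeta, genMap]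
  have h3 : (w, k) = (w, 1) * ((1, Multiplicative.ofAdd 1) : FreeGroup (Fin 2) × _) ^ k.toAdd := by
    ext
    · simp
    · simp [← ofAdd_zsmul]
  have h4 : toCoprodI (freeIncl 0 w) = ofProd (w, 1) := DFunLike.congr_fun h1 w
  rw [prodIncl_apply, map_mul, map_zpow, h2, h3, map_mul, map_zpow, h4]

/-- `Λ` as a free product of `FreeGroup (Fin 2) × ℤ` and a free group. -/
def equivCoprodI : GroupLambda ≃* Monoid.CoprodI Factor :=
  MonoidHom.toMulEquiv toCoprodI (Monoid.CoprodI.lift factorIncl)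
    (by
      refine PresentedGroup.ext fun x => ?_
      have hP : ∀ x, Monoid.CoprodI.lift factorIncl (ofProd x) = prodIncl x := fun x =>
        Monoid.CoprodI.lift_of factorIncl (i := true) x
      have hF : ∀ x, Monoid.CoprodI.lift factorIncl (ofFree x) = freeIncl 1 x := fun x =>
        Monoid.CoprodI.lift_of factorIncl (i := false) x
      rcases x with i | i | _
      · fin_cases i <;> simp [toCoprodI, genMap, hP, hF, prodIncl_apply, freeIncl]
      · fin_cases i <;> simp [toCoprodI, genMap, hP, hF, prodIncl_apply, freeIncl]
      · simp [toCoprodI, genMap, hP, prodIncl_apply, zeta])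
    (by
      refine Monoid.CoprodI.ext_hom _ _ fun b => ?_
      refine MonoidHom.ext fun x => ?_
      rw [MonoidHom.comp_apply, MonoidHom.comp_apply, Monoid.CoprodI.lift_of]
      cases b
      · exact toCoprodI_freeIncl_one x
      · exact toCoprodI_prodIncl x)

theorem equivCoprodI_symm_ofProd (w : FreeGroup (Fin 2)) (k : Multiplicative ℤ) :
    equivCoprodI.symm (ofProd (w, k)) = freeIncl 0 w * zeta ^ k.toAdd := by
  rw [MulEquiv.symm_apply_eq, ← prodIncl_apply]
  exact (toCoprodI_prodIncl _).symm

theorem equivCoprodI_zeta : equivCoprodI zeta = ofProd (1, Multiplicative.ofAdd 1) := by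
  rw [← MulEquiv.eq_symm_apply, equivCoprodI_symm_ofProd]
  simp

/-- The centralizer of `ζ` is the factor containing it. -/
theorem exists_eq_of_commute_zeta {x : GroupLambda} (hx : Commute x zeta) :
    ∃ (w : FreeGroup (Fin 2)) (k : ℤ), x = freeIncl 0 w * zeta ^ k := by
  have h := hx.map equivCoprodI
  rw [equivCoprodI_zeta] at h
  have hne : (1, Multiplicative.ofAdd 1) ≠ (1 : FreeGroup (Fin 2) × Multiplicative ℤ) :=
    fun h => one_ne_zero (Multiplicative.ofAdd.injective (congrArg Prod.snd h))
  obtain ⟨⟨w, k⟩, hw⟩ := Monoid.CoprodI.mem_range_of_commute_of (G := Factor) (i := true) hne h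
  refine ⟨w, k.toAdd, ?_⟩
  rw [← equivCoprodI_symm_ofProd, MulEquiv.eq_symm_apply]
  exact hw.symm

/-- The elements of `Λ` with noncommutative centralizer are the conjugates of powers of `ζ`. -/
theorem exists_eq_conj_zeta_zpow {z x y : GroupLambda} (hz : z ≠ 1) (hx : Commute x z)
    (hy : Commute y z) (hxy : ¬ Commute x y) :
    ∃ (g : GroupLambda) (k : ℤ), z = g * zeta ^ k * g⁻¹ := by
  have hx' := hx.map equivCoprodI
  have hy' := hy.map equivCoprodI
  have hxy' : ¬ Commute (equivCoprodI x) (equivCoprodI y) := fun h =>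
    hxy (by simpa using h.map equivCoprodI.symm)
  rcases Monoid.CoprodI.centralizer_commutative_or_conj_of (z := equivCoprodI z)
    (by simpa using hz) with h | ⟨g, b, m, hm, hzm, h⟩
  · exact absurd (h _ _ hx' hy') hxy'
  obtain ⟨x₁, hx₁, hx₂⟩ := h _ hx'
  obtain ⟨y₁, hy₁, hy₂⟩ := h _ hy'
  have hne : ¬ Commute x₁ y₁ := by
    intro hc
    rw [hx₂, hy₂, Commute.conj_iff] at hxy'
    exact hxy' (hc.map _)
  cases b
  · exact absurd (FreeGroup.commute_of_commute (ι := Fin 2) hm hx₁ hy₁) hne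
  · change FreeGroup (Fin 2) × Multiplicative ℤ at m x₁ y₁
    have hm1 : m.1 = 1 := by
      by_contra hm1
      have h1 := FreeGroup.commute_of_commute hm1 (hx₁.map (MonoidHom.fst _ _))
        (hy₁.map (MonoidHom.fst _ _))
      exact hne (Prod.ext h1 (mul_comm _ _))
    refine ⟨equivCoprodI.symm g, m.2.toAdd, ?_⟩
    have h2 : m = (1, m.2) := Prod.ext hm1 rfl
    have h3 := congrArg equivCoprodI.symm hzm
    rw [MulEquiv.symm_apply_apply, map_mul, map_mul, map_inv] at h3
    have h4 : equivCoprodI.symm (Monoid.CoprodI.of (M := Factor) (i := true) m) =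
        zeta ^ m.2.toAdd := by
      rw [h2]
      exact (equivCoprodI_symm_ofProd _ _).trans (by simp)
    rw [h3, h4]

/-- No two nontrivial elements of `Λ` have all their conjugates commuting. -/
theorem eq_one_or_eq_one_of_conj_commute {u v : GroupLambda}
    (h : ∀ g h, Commute (g * u * g⁻¹) (h * v * h⁻¹)) : u = 1 ∨ v = 1 := by
  have hF : ∀ m : FreeGroup (Fin 2), ∃ p : FreeGroup (Fin 2), p ≠ 1 ∧ p ≠ m := by
    intro m
    by_cases hm : m = FreeGroup.of 0
    · exact ⟨FreeGroup.of 1, FreeGroup.of_ne_one _, fun h => by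
        have := FreeGroup.of_injective (h.trans hm)
        exact absurd this (by decide)⟩
    · exact ⟨FreeGroup.of 0, FreeGroup.of_ne_one _, fun h => hm h.symm⟩
  have hP : ∀ m : FreeGroup (Fin 2) × Multiplicative ℤ, ∃ p, p ≠ 1 ∧ p ≠ m := by
    intro m
    obtain ⟨p, hp, hp'⟩ := hF m.1
    exact ⟨(p, 1), fun h => hp (congrArg Prod.fst h), fun h => hp' (congrArg Prod.fst h)⟩
  have key := Monoid.CoprodI.eq_one_or_eq_one_of_conj_commute (G := Factor) (i := true)
    (j := false) (by decide) hP hF (u := equivCoprodI u) (v := equivCoprodI v) (by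
      intro g k
      have h1 := (h (equivCoprodI.symm g) (equivCoprodI.symm k)).map equivCoprodI
      simpa using h1)
  simpa using key

/-- The retraction of `Λ` onto the free group on `α 0` and `τ 0`. -/
def toFree : GroupLambda →* FreeGroup (Fin 2) :=
  PresentedGroup.toGroup (rels := LambdaGen.rels) (f := fun x => match x with
    | α i => if i = 0 then FreeGroup.of 0 else 1
    | τ i => if i = 0 then FreeGroup.of 1 else 1
    | ζ => 1) (by
    rintro r (rfl | rfl) <;> simp [map_commutatorElement])

theorem toFree_freeIncl (w : FreeGroup (Fin 2)) : toFree (freeIncl 0 w) = w := by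
  have : toFree.comp (freeIncl 0) = MonoidHom.id _ := by
    refine FreeGroup.ext_hom _ _ fun k => ?_
    fin_cases k <;> simp [toFree, freeIncl]
  exact DFunLike.congr_fun this w

theorem toFree_zeta : toFree zeta = 1 := by simp [toFree, zeta]

/-- The exponent sum of `ζ`. -/
def zetaExponent : GroupLambda →* Multiplicative ℤ :=
  PresentedGroup.toGroup (rels := LambdaGen.rels) (f := fun x => match x with
    | ζ => Multiplicative.ofAdd 1
    | _ => 1) (by
    rintro r (rfl | rfl) <;> simp [map_commutatorElement])

theorem zetaExponent_zeta : zetaExponent zeta = Multiplicative.ofAdd 1 := by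
  simp [zetaExponent, zeta]

theorem zeta_ne_one : zeta ≠ 1 := by
  intro h
  have := congrArg zetaExponent h
  rw [zetaExponent_zeta, map_one zetaExponent, ← ofAdd_zero] at this
  exact one_ne_zero (Multiplicative.ofAdd.injective this)

end GroupLambda

/-! ### The maps `q n` and their kernels -/

section

open GroupLambda

theorem qMap_zeta (n : ℕ) : qMap n zeta = 1 := by
  simp [qMap, zeta, LambdaGen.toB]

theorem qMap_freeIncl (n : ℕ) (w : FreeGroup (Fin 2)) :
    qMap n (freeIncl 0 w) = GroupB.ofBaumslagSolitar (BaumslagSolitar.freeMap n w) := by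
  have : (qMap n).comp (freeIncl 0) =
      GroupB.ofBaumslagSolitar.comp (BaumslagSolitar.freeMap n) := by
    refine FreeGroup.ext_hom _ _ fun k => ?_
    fin_cases k <;>
      simp [qMap, freeIncl, BaumslagSolitar.freeMap, GroupB.ofBaumslagSolitar, LambdaGen.toB,
        GroupB.a, GroupB.t]
  exact DFunLike.congr_fun this w

theorem qMap_freeIncl_eq_one_iff {n : ℕ} {w : FreeGroup (Fin 2)} :
    qMap n (freeIncl 0 w) = 1 ↔ BaumslagSolitar.freeMap n w = 1 := by
  rw [qMap_freeIncl]
  exact map_eq_one_iff _ GroupB.ofBaumslagSolitar_injective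

theorem qMap_surjective (n : ℕ) : Function.Surjective (qMap n) := by
  rw [← MonoidHom.range_eq_top, eq_top_iff, ← GroupB.closure_eq_top, Subgroup.closure_le]
  have ht : ∀ i, GroupB.t i ∈ (qMap n).range := fun i =>
    ⟨PresentedGroup.of (.τ i), by simp [qMap, LambdaGen.toB, GroupB.t]⟩
  rintro _ (⟨i, rfl⟩ | ⟨i, rfl⟩)
  · refine Subgroup.mem_of_pow_two_pow_mem _ (GroupB.t_mul_a_sq_mul_t_inv i) (ht i) (n := n) ?_
    exact ⟨PresentedGroup.of (.α i), by simp [qMap, LambdaGen.toB, GroupB.a]⟩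
  · exact ht i

/-- An automorphism sending `ζ` to `ζ ^ k` with `k = ± 1` preserves the centralizer of `ζ`. -/
theorem GroupLambda.exists_map_freeIncl_eq (φ : GroupLambda ≃* GroupLambda) {k : ℤ} (hk : IsUnit k)
    (hφ : φ zeta = zeta ^ k) (w : FreeGroup (Fin 2)) :
    ∃ i : ℤ, φ (freeIncl 0 w) = freeIncl 0 (toFree (φ (freeIncl 0 w))) * zeta ^ i := by
  have h1 : Commute (φ (freeIncl 0 w)) zeta := by
    have h2 := ((commute_freeIncl_zeta w).map φ).zpow_right k
    rwa [hφ, ← zpow_mul, Int.isUnit_mul_self hk, zpow_one] at h2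
  obtain ⟨w', i, h⟩ := exists_eq_of_commute_zeta h1
  refine ⟨i, ?_⟩
  rw [h, map_mul, map_zpow, toFree_zeta, one_zpow, mul_one, toFree_freeIncl]

/-- An automorphism of `Λ` sends `ζ` to a conjugate of `ζ` or `ζ⁻¹`. -/
theorem GroupLambda.exists_map_zeta_eq (φ : GroupLambda ≃* GroupLambda) :
    ∃ (g : GroupLambda) (k : ℤ), IsUnit k ∧ φ zeta = g * zeta ^ k * g⁻¹ := by
  have key : ∀ φ : GroupLambda ≃* GroupLambda, ∃ (g : GroupLambda) (k : ℤ),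
      φ zeta = g * zeta ^ k * g⁻¹ := by
    intro φ
    refine exists_eq_conj_zeta_zpow (by simpa using zeta_ne_one)
      ((commute_freeIncl_zeta (FreeGroup.of 0)).map φ)
      ((commute_freeIncl_zeta (FreeGroup.of 1)).map φ) fun h => ?_
    have h1 := h.map φ.symm
    rw [MulEquiv.symm_apply_apply, MulEquiv.symm_apply_apply] at h1
    have h2 := h1.map toFree
    rw [toFree_freeIncl, toFree_freeIncl] at h2
    exact absurd (congrArg FreeGroup.toWord h2.eq) (by decide)
  obtain ⟨g, k, hg⟩ := key φ
  obtain ⟨h, l, hh⟩ := key φ.symm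
  refine ⟨g, k, ?_, hg⟩
  have h1 := congrArg φ hh
  rw [MulEquiv.apply_symm_apply, map_mul, map_mul, map_zpow, hg, map_inv] at h1
  have h2 := congrArg (fun x => (zetaExponent x).toAdd) h1
  simp only [map_mul, map_inv, map_zpow, zetaExponent_zeta, toAdd_mul, toAdd_inv, toAdd_zpow,
    toAdd_ofAdd, smul_eq_mul] at h2
  refine IsUnit.of_mul_eq_one l ?_
  linear_combination -h2

/-- After composition with an inner automorphism, an automorphism of `Λ` induces an automorphism of
the free group on `α 0` and `τ 0`, to which `eq_of_ker_freeMap_equiv` applies. -/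
theorem eq_of_ker_qMap_equiv (φ : GroupLambda ≃* GroupLambda) {n m : ℕ}
    (hφ : ∀ x, qMap n x = 1 ↔ qMap m (φ x) = 1) : n = m := by
  obtain ⟨g, k, hk, hg⟩ := exists_map_zeta_eq φ
  let φ' : GroupLambda ≃* GroupLambda := φ.trans (MulAut.conj g⁻¹)
  have hφ' : ∀ x, qMap n x = 1 ↔ qMap m (φ' x) = 1 := by
    intro x
    have h1 : φ' x = g⁻¹ * φ x * g⁻¹⁻¹ := rfl
    rw [hφ, h1, map_mul, map_mul, map_inv (qMap m) g⁻¹, conj_eq_one_iff]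
  have hz : φ' zeta = zeta ^ k := by
    simp [φ', MulEquiv.trans_apply, hg, mul_assoc]
  have hz' : φ'.symm zeta = zeta ^ k := by
    rw [MulEquiv.symm_apply_eq, map_zpow, hz, ← zpow_mul, Int.isUnit_mul_self hk, zpow_one]
  have hinv : ∀ ψ : GroupLambda ≃* GroupLambda, ψ zeta = zeta ^ k → ψ.symm zeta = zeta ^ k →
      ∀ w, toFree (ψ.symm (freeIncl 0 (toFree (ψ (freeIncl 0 w))))) = w := by
    intro ψ hψ hψ' w
    obtain ⟨i, hi⟩ := exists_map_freeIncl_eq ψ hk hψ w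
    rw [eq_mul_inv_of_mul_eq hi.symm, map_mul, map_inv, map_zpow, hψ', MulEquiv.symm_apply_apply,
      map_mul, toFree_freeIncl]
    simp [toFree_zeta]
  let θ : FreeGroup (Fin 2) ≃* FreeGroup (Fin 2) :=
    MonoidHom.toMulEquiv (toFree.comp (φ'.toMonoidHom.comp (freeIncl 0)))
      (toFree.comp (φ'.symm.toMonoidHom.comp (freeIncl 0)))
      (MonoidHom.ext fun w => hinv φ' hz hz' w)
      (MonoidHom.ext fun w => hinv φ'.symm hz' hz w)
  refine BaumslagSolitar.eq_of_ker_freeMap_equiv θ fun w => ?_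
  obtain ⟨i, hi⟩ := exists_map_freeIncl_eq φ' hk hz w
  have hθ : θ w = toFree (φ' (freeIncl 0 w)) := rfl
  rw [← qMap_freeIncl_eq_one_iff, ← qMap_freeIncl_eq_one_iff, hφ', hi, map_mul, map_zpow,
    qMap_zeta, one_zpow, mul_one, hθ]

/-! ### Fibre products over `B` -/

/-- Two noncommuting elements of the kernel: the relator of `BS(2, 3)` and a conjugate of it. -/
theorem exists_freeMap_eq_one_not_commute (n : ℕ) : ∃ r s : FreeGroup (Fin 2),
    BaumslagSolitar.freeMap n r = 1 ∧ BaumslagSolitar.freeMap n s = 1 ∧ ¬ Commute r s := by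
  set x : FreeGroup (Fin 2) := FreeGroup.of 0
  set y : FreeGroup (Fin 2) := FreeGroup.of 1
  have hr : BaumslagSolitar.freeMap n (y * x ^ 2 * y⁻¹ * (x ^ 3)⁻¹) = 1 := by
    have h := congrArg (· ^ 2 ^ n) BaumslagSolitar.t_mul_a_sq_mul_t_inv
    simp only [conj_pow, ← pow_mul] at h
    simp only [BaumslagSolitar.freeMap, map_mul, map_pow, map_inv, FreeGroup.lift_apply_of, x, y,
      Matrix.cons_val_zero, Matrix.cons_val_one, ← pow_mul]
    rw [mul_inv_eq_one, mul_comm (2 ^ n), mul_comm (2 ^ n), h]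
  refine ⟨y * x ^ 2 * y⁻¹ * (x ^ 3)⁻¹, y * (y * x ^ 2 * y⁻¹ * (x ^ 3)⁻¹) * y⁻¹, hr, ?_, ?_⟩
  · rw [map_mul, map_mul, hr, mul_one, ← map_mul, mul_inv_cancel, map_one]
  -- the images in the symmetric group on three letters do not commute
  · intro h
    have h1 := h.map (FreeGroup.lift ![Equiv.swap (0 : Fin 3) 1, Equiv.swap 1 2])
    simp only [map_mul, map_inv, FreeGroup.lift_apply_of, x, y, Matrix.cons_val_zero,
      Matrix.cons_val_one, pow_succ, pow_zero, one_mul, Equiv.swap_mul_self, Equiv.swap_inv] at h1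
    exact absurd (Equiv.congr_fun h1.eq 0) (by decide)

namespace IsGromovHyperbolic

variable {Γ : Type*} [Group Γ]

/-- A torsion-free hyperbolic group mapping onto the perfect noncommutative group `B` is not
metabelian, so it has no nontrivial abelian normal subgroup. -/
theorem eq_one_of_conj_commute_of_surjective (h : IsGromovHyperbolic Γ)
    (htf : ∀ g : Γ, g ≠ 1 → ¬ IsOfFinOrder g) {f : Γ →* GroupB} (hf : Function.Surjective f)
    {g : Γ} (hg : ∀ k, Commute (k * g * k⁻¹) g) : g = 1 := by
  by_contra hne
  have hcomm := h.commute_commutator_of_conj_commute htf hne hg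
  have hmap : (commutator Γ).map f = ⊤ := by
    rw [commutator_def, Subgroup.map_commutator, Subgroup.map_top_of_surjective f hf,
      ← commutator_def, GroupB.commutator_eq_top]
  have hB : ∀ b : GroupB, ∃ x ∈ commutator Γ, f x = b := fun b =>
    Subgroup.mem_map.1 (hmap ▸ Subgroup.mem_top b)
  obtain ⟨x, hx, hxa⟩ := hB (GroupB.a 0)
  obtain ⟨y, hy, hya⟩ := hB (GroupB.t 0 * GroupB.a 0 * (GroupB.t 0)⁻¹)
  refine GroupB.not_commute_a_conj ?_
  rw [← hya, ← hxa]
  exact (hcomm x hx y hy).map f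

/-- If all conjugates of `u` commute with all conjugates of `v`, then commutative transitivity makes
the conjugates of `v` commute with each other. -/
theorem eq_one_or_eq_one_of_conj_commute (h : IsGromovHyperbolic Γ)
    (htf : ∀ g : Γ, g ≠ 1 → ¬ IsOfFinOrder g) {f : Γ →* GroupB} (hf : Function.Surjective f)
    {u v : Γ} (huv : ∀ g k, Commute (g * u * g⁻¹) (k * v * k⁻¹)) : u = 1 ∨ v = 1 := by
  by_contra! hne
  refine hne.2 (h.eq_one_of_conj_commute_of_surjective htf hf fun k => ?_)
  have h1 := huv 1 k
  have h2 := huv 1 1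
  simp only [one_mul, inv_one, mul_one] at h1 h2
  exact h.commute_of_commute htf hne.1 h1.symm h2.symm

/-- The group `B` is not commutative-transitive: `a ^ 3` commutes with `a` and with `t * a * t⁻¹`.
So no surjection onto `B` is injective. -/
theorem exists_map_eq_one_of_surjective (h : IsGromovHyperbolic Γ)
    (htf : ∀ g : Γ, g ≠ 1 → ¬ IsOfFinOrder g) {f : Γ →* GroupB} (hf : Function.Surjective f) :
    ∃ x, x ≠ 1 ∧ f x = 1 := by
  by_contra! hinj
  have hinj' : Function.Injective f :=
    (injective_iff_map_eq_one f).2 fun x hx => by_contra fun hne => hinj x hne hx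
  obtain ⟨x, hx⟩ := hf (GroupB.a 0)
  obtain ⟨y, hy⟩ := hf (GroupB.t 0)
  have hrel : y * x ^ 2 * y⁻¹ = x ^ 3 := hinj' (by
    simp [hx, hy, GroupB.t_mul_a_sq_mul_t_inv])
  have hne : x ^ 3 ≠ 1 := fun h1 => GroupB.a_pow_three_ne_one (by rw [← hx, ← map_pow, h1, map_one])
  have h1 : Commute (y * x * y⁻¹) (x ^ 3) := by
    rw [← hrel, Commute.conj_iff]
    exact (Commute.refl x).pow_right 2
  have h2 := (h.commute_of_commute htf hne ((Commute.refl x).pow_right 3) h1).map f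
  exact GroupB.not_commute_a_conj (by simpa [hx, hy] using h2)

end IsGromovHyperbolic

namespace FibreProduct

variable {Γ : Type*} [Group Γ] {π₀ : Γ →* GroupB}

theorem mem_iff {G H Q : Type*} [Group G] [Group H] [Group Q] {f : G →* Q} {g : H →* Q}
    {p : G × H} : p ∈ fibreProduct f g ↔ f p.1 = g p.2 := Iff.rfl

theorem fst_surjective {G H Q : Type*} [Group G] [Group H] [Group Q] {f : G →* Q} {g : H →* Q}
    (hg : Function.Surjective g) (x : G) : ∃ p : fibreProduct f g, p.1.1 = x := by
  obtain ⟨y, hy⟩ := hg (f x)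
  exact ⟨⟨(x, y), hy.symm⟩, rfl⟩

theorem snd_surjective {G H Q : Type*} [Group G] [Group H] [Group Q] {f : G →* Q} {g : H →* Q}
    (hf : Function.Surjective f) (y : H) : ∃ p : fibreProduct f g, p.1.2 = y := by
  obtain ⟨x, hx⟩ := hf (g y)
  exact ⟨⟨(x, y), hx⟩, rfl⟩

/-- The two kernels of the projections commute elementwise, and so do their images under an
isomorphism, even after conjugation. -/
theorem conj_commute {G H Q P : Type*} [Group G] [Group H] [Group Q] [Group P] {f : G →* Q}
    {g : H →* Q} (F : fibreProduct f g ≃* P) {p c : fibreProduct f g} (hp : p.1.2 = 1)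
    (hc : c.1.1 = 1) (k l : P) : Commute (k * F p * k⁻¹) (l * F c * l⁻¹) := by
  have h : Commute (F.symm k * p * (F.symm k)⁻¹) (F.symm l * c * (F.symm l)⁻¹) := by
    refine Subtype.ext (Prod.ext ?_ ?_)
    · simp [hc]
    · simp [hp]
  simpa using h.map F

/-- An isomorphism of fibre products maps the kernel of the projection to `Λ` to the corresponding
kernel. Otherwise it maps the kernel of `q n` into `Γ`, but in that kernel the element `ζ` has
noncommutative centralizer. -/
theorem snd_eq_one (h : IsGromovHyperbolic Γ)
    (htf : ∀ g : Γ, g ≠ 1 → ¬ IsOfFinOrder g) (hπ : Function.Surjective π₀)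
    {n m : ℕ} (F : fibreProduct π₀ (qMap n) ≃* fibreProduct π₀ (qMap m))
    {p : fibreProduct π₀ (qMap n)} (hp : p.1.2 = 1) : (F p).1.2 = 1 := by
  by_contra hne
  have hsnd : ∀ c : fibreProduct π₀ (qMap n), c.1.1 = 1 → (F c).1.2 = 1 := by
    intro c hc
    refine (GroupLambda.eq_one_or_eq_one_of_conj_commute (u := (F p).1.2) (v := (F c).1.2)
      fun k l => ?_).resolve_left hne
    obtain ⟨k, rfl⟩ := snd_surjective (f := π₀) (g := qMap m) hπ k
    obtain ⟨l, rfl⟩ := snd_surjective (f := π₀) (g := qMap m) hπ l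
    exact (conj_commute F hp hc k l).map ((MonoidHom.snd _ _).comp (Subgroup.subtype _))
  obtain ⟨r, s, hr, hs, hrs⟩ := exists_freeMap_eq_one_not_commute n
  let incl : ∀ y, qMap n y = 1 → fibreProduct π₀ (qMap n) := fun y hy =>
    ⟨(1, y), by rw [mem_iff, map_one, hy]⟩
  let z := incl zeta (qMap_zeta n)
  let r' := incl (GroupLambda.freeIncl 0 r) (qMap_freeIncl_eq_one_iff.2 hr)
  let s' := incl (GroupLambda.freeIncl 0 s) (qMap_freeIncl_eq_one_iff.2 hs)
  have hz : (F z).1.1 ≠ 1 := by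
    intro h1
    have h2 : F z = 1 := Subtype.ext (Prod.ext h1 (hsnd z rfl))
    have h3 : z = 1 := by simpa using h2
    exact zeta_ne_one (congrArg (fun p => p.1.2) h3)
  have hcz : ∀ w (hw : qMap n (GroupLambda.freeIncl 0 w) = 1),
      Commute (F (incl _ hw)).1.1 (F z).1.1 := by
    intro w hw
    have h1 : Commute (incl _ hw) z :=
      Subtype.ext (Prod.ext rfl (commute_freeIncl_zeta w).eq)
    exact (h1.map F).map ((MonoidHom.fst _ _).comp (Subgroup.subtype _))
  have h1 : Commute (F r').1.1 (F s').1.1 := h.commute_of_commute htf hz (hcz r (qMap_freeIncl_eq_one_iff.2 hr))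
    (hcz s (qMap_freeIncl_eq_one_iff.2 hs))
  have h2 : Commute (F r') (F s') := by
    refine Subtype.ext (Prod.ext h1 ?_)
    simp [hsnd r' rfl, hsnd s' rfl]
  have h3 : Commute r' s' := by simpa using h2.map F.symm
  have h4 : Commute (GroupLambda.freeIncl 0 r) (GroupLambda.freeIncl 0 s) :=
    h3.map ((MonoidHom.snd _ _).comp (Subgroup.subtype _))
  have h5 := h4.map toFree
  rw [toFree_freeIncl, toFree_freeIncl] at h5
  exact hrs h5

/-- The kernel of the projection to `Γ` is respected too: its image commutes with the image of
the kernel of `π₀`, which is nontrivial. -/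
theorem fst_eq_one (h : IsGromovHyperbolic Γ)
    (htf : ∀ g : Γ, g ≠ 1 → ¬ IsOfFinOrder g) (hπ : Function.Surjective π₀)
    {n m : ℕ} (F : fibreProduct π₀ (qMap n) ≃* fibreProduct π₀ (qMap m))
    {c : fibreProduct π₀ (qMap n)} (hc : c.1.1 = 1) : (F c).1.1 = 1 := by
  obtain ⟨x, hx, hx'⟩ := h.exists_map_eq_one_of_surjective htf hπ
  let p : fibreProduct π₀ (qMap n) := ⟨(x, 1), by rw [mem_iff, map_one, hx']⟩
  have hp : (F p).1.1 ≠ 1 := by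
    intro h1
    have h2 : F p = 1 := Subtype.ext (Prod.ext h1 (snd_eq_one h htf hπ F rfl))
    have h3 : p = 1 := by simpa using h2
    exact hx (congrArg (fun p => p.1.1) h3)
  refine (h.eq_one_or_eq_one_of_conj_commute htf hπ (u := (F p).1.1) fun k l => ?_).resolve_left hp
  obtain ⟨k, rfl⟩ := fst_surjective (f := π₀) (qMap_surjective m) k
  obtain ⟨l, rfl⟩ := fst_surjective (f := π₀) (qMap_surjective m) l
  exact (conj_commute F (p := p) rfl hc k l).map ((MonoidHom.fst _ _).comp (Subgroup.subtype _))

/-- An isomorphism of fibre products induces an automorphism of `Λ` matching the kernels of `q n`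
and `q m`. -/
theorem eq_of_mulEquiv (h : IsGromovHyperbolic Γ)
    (htf : ∀ g : Γ, g ≠ 1 → ¬ IsOfFinOrder g) (hπ : Function.Surjective π₀)
    {n m : ℕ} (F : fibreProduct π₀ (qMap n) ≃* fibreProduct π₀ (qMap m)) : n = m := by
  let snd : ∀ k, fibreProduct π₀ (qMap k) →* GroupLambda := fun k =>
    (MonoidHom.snd _ _).comp (Subgroup.subtype _)
  obtain ⟨φ, hφ⟩ := MonoidHom.exists_mulEquiv_of_ker_eq (p := snd n) (p' := snd m)
    (snd_surjective hπ) (snd_surjective hπ) F fun p =>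
      ⟨fun hp => snd_eq_one h htf hπ F hp, fun hp => by
        have h1 := snd_eq_one h htf hπ F.symm hp
        rwa [MulEquiv.symm_apply_apply] at h1⟩
  have hle : ∀ {n m : ℕ} (F : fibreProduct π₀ (qMap n) ≃* fibreProduct π₀ (qMap m))
      {y : GroupLambda} (hy : qMap n y = 1),
      qMap m (F ⟨(1, y), by rw [mem_iff, map_one, hy]⟩).1.2 = 1 := by
    intro n m F y hy
    rw [← mem_iff.1 (F _).2, fst_eq_one h htf hπ F rfl, map_one]
  refine eq_of_ker_qMap_equiv φ fun y => ⟨fun hy => ?_, fun hy => ?_⟩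
  · have h1 := hle F hy
    have h2 : φ y = _ := hφ ⟨(1, y), by rw [mem_iff, map_one, hy]⟩
    rw [h2]
    exact h1
  · have h1 := hle F.symm hy
    have h2 := hφ (F.symm ⟨(1, φ y), by rw [mem_iff, map_one, hy]⟩)
    rw [MulEquiv.apply_symm_apply] at h2
    have h3 := φ.injective h2
    rw [← h3]
    exact h1

end FibreProduct

end

theorem corollary8p4 :
    (∀ n : ℕ, Function.Surjective (qMap n)) ∧
    (∀ n m : ℕ, n ≠ m →
      ¬ ∃ φ : GroupLambda ≃* GroupLambda,
        (qMap n).ker.map φ.toMonoidHom = (qMap m).ker) ∧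
    (∀ (Γ : Type*) [Group Γ], IsGromovHyperbolic Γ → (∀ g : Γ, g ≠ 1 → ¬ IsOfFinOrder g) →
      ∀ π₀ : Γ →* GroupB, Function.Surjective π₀ →
        ∀ n m : ℕ, n ≠ m →
          IsEmpty (fibreProduct π₀ (qMap n) ≃* fibreProduct π₀ (qMap m))) := by
  refine ⟨qMap_surjective, ?_, ?_⟩
  · rintro n m hnm ⟨φ, hφ⟩
    refine hnm (eq_of_ker_qMap_equiv φ fun x => ?_)
    rw [← MonoidHom.mem_ker, ← MonoidHom.mem_ker, ← hφ]
    exact (Subgroup.mem_map_iff_mem φ.injective).symm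
  · intro Γ _ h htf π₀ hπ n m hnm
    exact ⟨fun F => hnm (FibreProduct.eq_of_mulEquiv h htf hπ F)⟩
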